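/- Let $n\ge 1$ and $l\ge 0$ be integers. For $m\ge 0$ let $$R_{n,m}(X_1,\dots,X_n)=\prod_{i=1}^n (X_i^{-1}+1+X_i)\;\frac{\det_{1\le i,j\le n}\left(X_i^{j-1}(1+X_i)^{j-1}-X_i^{m+2n-j}(1+X_i^{-1})^{j-1}\right)}{\prod_{i=1}^n(1-X_i)\prod_{1\le i<j\le n}(1-X_iX_j)(X_j-X_i)}\in\mathbb{Q}(X_1,\dots,X_n),$$ which is the case $w=0$ of $$\prod_{i=1}^{n} (X_i^{-1} + 1+w + X_i)\frac{\det_{1 \le i, j \le n} \left( X_i^{j-1} (1+X_i)^{j-1} (1+ w X_i)^{n-j} - X_i^{m+2n-j} (1+X_i^{-1})^{j-1} (1+w X_i^{-1})^{n-j} \right)}{\prod_{i=1}^n (1-X_i) \prod_{1 \le i < j \le n} (1-X_i X_j)(X_j-X_i)}.$$ A plane partition on a finite set of cells is a filling with positive integers that is weakly decreasing along rows (from left to right) and down columns; it is row-strict (column-strict) if it is strictly decreasing along rows (down columns). The complement of a partition $\lambda=(\lambda_1,\dots,\lambda_n)$ with $\lambda_1\le l$ in the $n\times l$ rectangle is the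 partition $\mu$ with $\mu_i=l-\lambda_{n+1-i}$, $1\le i\le n$. (1) If $l\ge n-2$, then $R_{n,2l+1}$ is the generating function of the (finitely many) pairs $(P,Q)$ such that $P$ is a column-strict plane partition of some shape $\lambda\subseteq n\times l$ whose entries in the $i$-th row are at most $2n+2-2i$, and $Q$ is a row-strict plane partition whose shape is the complement $\mu$ of $\lambda$ in the $n\times l$ rectangle and whose entries in the $i$-th row are at most $n-i$, with respect to the weight $$\prod_{i=1}^n X_i^l(X_i^{-1}+1+X_i)(1+X_i)\,X_i^{\#\text{ of }2i-1\text{ in }P}\,X_i^{-\#\text{ of }2i\text{ in }P}.$$ (2) If $l\ge n-1$, then $R_{n,2l}$ is the generating function of the (finitely many) pairs $(P,Q)$ such that $P$ is a column-strict plane partition of some shape $\lambda\subseteq n\times l$ whose entries in the $i$-th row are at most $2n+2-2i$, and $Q$ is a row-strict plane partition on the set of cells obtained from the complement $\mu$ of $\lambda$ in the $n\times l$ rectangle by deleting some (possibly none or all) of the cells in the first column of $\mu$, whose entries in the $i$-th row are at most $n-i$, and whose first column remains weakly decreasing when each deleted cell, say in row $i$, is filled with the part $n+1-i$; pairs with different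 sets of deleted cells are different. The weight is $$\prod_{i=1}^n X_i^l(X_i^{-1}+1+X_i)\,X_i^{\#\text{ of }2i-1\text{ in }P}\,X_i^{-\#\text{ of }2i\text{ in }P}.$$ -/

import Mathlib

/-- The bounded Littlewood-type right-hand side
`∏ (x_i⁻¹ + 1 + w + x_i) * det (...) / (∏ (1 - x_i) ∏_{i<j} (1 - x_i x_j)(x_j - x_i))`.
The rows and columns are indexed from `0`, so the column index `j : Fin n` stands for `j + 1`. -/
noncomputable def littlewoodRHS {K : Type*} [Field K] (n m : ℕ) (w : K) (x : Fin n → K) : K :=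
  (∏ i, ((x i)⁻¹ + 1 + w + x i)) *
    (Matrix.det (Matrix.of fun i j : Fin n =>
        x i ^ (j : ℕ) * (1 + x i) ^ (j : ℕ) * (1 + w * x i) ^ (n - 1 - (j : ℕ))
        - x i ^ (m + 2 * n - ((j : ℕ) + 1)) * (1 + (x i)⁻¹) ^ (j : ℕ)
            * (1 + w * (x i)⁻¹) ^ (n - 1 - (j : ℕ))) /
      ((∏ i, (1 - x i)) *
        ∏ i, ∏ j ∈ Finset.Ioi i, (1 - x i * x j) * (x j - x i)))

/-- The indeterminates `X_1, …, X_n` in the field of rational functions `ℚ(X_1, …, X_n)`,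
realised as the fraction field of `ℤ[X_1, …, X_n]`. -/
noncomputable def indet (n : ℕ) (i : Fin n) : FractionRing (MvPolynomial (Fin n) ℤ) :=
  algebraMap (MvPolynomial (Fin n) ℤ) (FractionRing (MvPolynomial (Fin n) ℤ)) (MvPolynomial.X i)

/-- A plane partition on a finite set `S` of cells `(row, column)` (both indexed from `0`):
positive integers in the cells of `S`, weakly decreasing along rows and down columns.
Entries outside `S` are set to `0`, so that a plane partition is determined by its cells. -/
@[ext]
structure PlanePartition (S : Finset (ℕ × ℕ)) where
  entry : ℕ → ℕ → ℕ
  pos : ∀ i j, (i, j) ∈ S → 0 < entry i j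
  zero : ∀ i j, (i, j) ∉ S → entry i j = 0
  row_weak : ∀ i j j', (i, j) ∈ S → (i, j') ∈ S → j < j' → entry i j' ≤ entry i j
  col_weak : ∀ i i' j, (i, j) ∈ S → (i', j) ∈ S → i < i' → entry i' j ≤ entry i j

namespace PlanePartition

variable {S : Finset (ℕ × ℕ)}

/-- Strict decrease along rows. -/
def RowStrict (T : PlanePartition S) : Prop :=
  ∀ i j j', (i, j) ∈ S → (i, j') ∈ S → j < j' → T.entry i j' < T.entry i j

/-- Strict decrease down columns. -/
def ColumnStrict (T : PlanePartition S) : Prop :=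
  ∀ i i' j, (i, j) ∈ S → (i', j) ∈ S → i < i' → T.entry i' j < T.entry i j

/-- The entries in row `i` are at most `b i` (rows indexed from `0`). -/
def RowBounded (T : PlanePartition S) (b : ℕ → ℕ) : Prop :=
  ∀ i j, (i, j) ∈ S → T.entry i j ≤ b i

/-- The number of entries equal to `k`. -/
def count (T : PlanePartition S) (k : ℕ) : ℕ :=
  (S.filter fun c => T.entry c.1 c.2 = k).card

end PlanePartition

/-- The cells of the rectangle with `n` rows and `l` columns. -/
def rectangle (n l : ℕ) : Finset (ℕ × ℕ) := Finset.range n ×ˢ Finset.range l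

/-- The complement of `lam` in the `n × l` rectangle, rotated by a half turn:
its `i`-th row (`1 ≤ i ≤ n`) has `l - lam_{n+1-i}` cells. -/
def complementShape (n l : ℕ) (lam : YoungDiagram) : Finset (ℕ × ℕ) :=
  (rectangle n l).filter fun c => (n - 1 - c.1, l - 1 - c.2) ∉ lam

/-- `∏ x_i ^ (# of 2i-1 in P) * x_i ^ (- # of 2i in P)`; here `i : Fin n` stands for `i + 1`. -/
noncomputable def entryWeight {K : Type*} [Field K] {n : ℕ} (x : Fin n → K)
    {S : Finset (ℕ × ℕ)} (P : PlanePartition S) : K :=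
  ∏ i : Fin n, x i ^ (P.count (2 * (i : ℕ) + 1) : ℤ) * x i ^ (-(P.count (2 * (i : ℕ) + 2) : ℤ))

/-- The pairs `(P, Q)` for odd `m = 2 * l + 1`. Row `i` of the code is row `i + 1` of the text,
so the bounds `2n+2-2i` and `n-i` become `2n-2i` and `n-1-i`. -/
structure OddPair (n l : ℕ) where
  shape : YoungDiagram
  shape_le : shape.cells ⊆ rectangle n l
  P : PlanePartition shape.cells
  P_strict : P.ColumnStrict
  P_bound : P.RowBounded fun i => 2 * n - 2 * i
  Q : PlanePartition (complementShape n l shape)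
  Q_strict : Q.RowStrict
  Q_bound : Q.RowBounded fun i => n - 1 - i

/-- The weight of a pair for `m = 2 * l + 1`. -/
noncomputable def OddPair.weight {K : Type*} [Field K] {n l : ℕ} (x : Fin n → K)
    (p : OddPair n l) : K :=
  (∏ i, x i ^ l * ((x i)⁻¹ + 1 + x i) * (1 + x i)) * entryWeight x p.P

/-- The pairs `(P, Q)` for even `m = 2 * l`. The shape of `Q` is the complement of the shape of
`P` in the `n × l` rectangle with a set `deleted` of cells of its first column removed; the
columns of `Q` have to decrease weakly also when the removed cell in row `i` (of `1, …, n`) is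
regarded as containing the part `n + 1 - i`. As the entries of `Q` in row `i` are at most
`n - i`, this only constrains the cells of the first column that lie above a removed cell. -/
structure EvenPair (n l : ℕ) where
  shape : YoungDiagram
  shape_le : shape.cells ⊆ rectangle n l
  P : PlanePartition shape.cells
  P_strict : P.ColumnStrict
  P_bound : P.RowBounded fun i => 2 * n - 2 * i
  deleted : Finset (ℕ × ℕ)
  deleted_subset : deleted ⊆ complementShape n l shape
  deleted_col : ∀ c ∈ deleted, c.2 = 0
  Q : PlanePartition (complementShape n l shape \ deleted)
  Q_strict : Q.RowStrict
  Q_bound : Q.RowBounded fun i => n - 1 - i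
  Q_deleted : ∀ i i', (i, 0) ∈ complementShape n l shape \ deleted → (i', 0) ∈ deleted →
    i < i' → n - i' ≤ Q.entry i 0

/-- The weight of a pair for `m = 2 * l`. -/
noncomputable def EvenPair.weight {K : Type*} [Field K] {n l : ℕ} (x : Fin n → K)
    (p : EvenPair n l) : K :=
  (∏ i, x i ^ l * ((x i)⁻¹ + 1 + x i)) * entryWeight x p.P

/-! Put S_k(e) = (1+x⁻¹)^k x^e - (1+x)^k x^(-e). Taking -x_i^(l+n) out of row i turns the
determinant in the numerator into det S_j(l+n-j) (0-based j) when m = 2l+1. When m = 2l the same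
works after row i is multiplied by 1+x_i, and gives det S_{j+1}(l+n-j). This extra factor is why
1+X_i appears in the odd weight only.

The rule S_{k+1}(e) = S_k(e) + S_k(e-1) lowers the orders to 0, one unit at a time, starting with
the columns of highest order. Each step lets some parts of a partition `mu` grow by one. Choices
that break monotonicity give two equal columns, so the growth histories are row-strict plane
partitions `Q` of shape `mu`, with first-row bound R = n-1 (odd) or R = n (even). The condition on l
makes R ≤ l+1, and a first part l+1 contributes a zero column, so only `mu` inside the rectangle
survives (`shiftedDet_eq_finsum`, `det_shiftedOddPow`).

What remains for each `mu` is, up to sign, the numerator of the Weyl character formula of Sp(2n) for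
the complementary partition. Column operations peel off one variable as two horizontal strips, with
weights x_0 and x_0⁻¹ (`det_oddPow`). Removing the ones and then the twos from `P` obeys the same
recursion (`finsum_isColumnStrictFilling`). The Weyl denominator cancels against the Littlewood
denominator (`symplecticDenom_mul`).

In the even case row i (0-based) of `Q` may reach n-i. By row-strictness that value occurs only in
the first column, and the cells containing it are the deleted cells of `EvenPair`. -/

/-! ### Padded sequences and interlacing -/

/-- Extension of a finite sequence of natural numbers by zeros. -/
def padded {n : ℕ} (a : Fin n → ℕ) (i : ℕ) : ℕ := if h : i < n then a ⟨i, h⟩ else 0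

theorem padded_val {n : ℕ} (a : Fin n → ℕ) (i : Fin n) : padded a i = a i := by simp [padded]

theorem padded_of_lt {n : ℕ} (a : Fin n → ℕ) {i : ℕ} (h : i < n) : padded a i = a ⟨i, h⟩ := by
  simp [padded, h]

theorem padded_of_le {n : ℕ} (a : Fin n → ℕ) {i : ℕ} (h : n ≤ i) : padded a i = 0 := by
  simp [padded, Nat.not_lt.2 h]

theorem padded_injective {n : ℕ} : Function.Injective (padded (n := n)) := fun a b h =>
  funext fun i => by rw [← padded_val a, ← padded_val b, h]

theorem padded_restrict {n : ℕ} {a : ℕ → ℕ} (ha : ∀ i, n ≤ i → a i = 0) :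
    padded (fun i : Fin n => a i) = a := by
  funext i
  by_cases h : i < n
  · simp [padded, h]
  · rw [padded_of_le _ (not_lt.1 h), ha i (not_lt.1 h)]

/-- A sequence interlacing with an antitone sequence is antitone. -/
theorem antitone_padded_of_interlace {n : ℕ} {lam : ℕ → ℕ} {k : Fin n → ℕ}
    (hk : k ∈ Fintype.piFinset fun i : Fin n => Finset.Icc (lam (i + 1)) (lam i)) :
    Antitone (padded k) := by
  refine antitone_nat_of_succ_le fun i => ?_
  rw [Fintype.mem_piFinset] at hk
  by_cases h : i + 1 < n
  · rw [padded_of_lt k h, padded_of_lt k (by omega : i < n)]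
    have h1 := Finset.mem_Icc.1 (hk ⟨i + 1, h⟩)
    have h2 := Finset.mem_Icc.1 (hk ⟨i, by omega⟩)
    exact h1.2.trans h2.1
  · rw [padded_of_le k (not_lt.1 h)]
    exact Nat.zero_le _

/-! ### Column operations and the branching rule for determinants -/

/-- With a = lam_j and b = lam_{j+1} the remainder is a multiple of the next column of the
determinant, so a column operation removes it. The sum left over runs over the interlacing values k.
-/
theorem sum_Icc_telescope {K : Type*} [CommRing K] (y : ℤ → K) (z : K) (t : ℤ) {a b : ℕ}
    (h : b ≤ a) :
    y (a + t + 1) = (∑ k ∈ Finset.Icc b a, z ^ (a - k) * (y (k + t + 1) - z * y (k + t)))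
      + z ^ (a - b + 1) * y (b + t) := by
  induction a, h using Nat.le_induction with
  | base => simp
  | succ a hab ih =>
    rw [Finset.sum_Icc_succ_top (by omega)]
    have h1 : ∑ k ∈ Finset.Icc b a, z ^ (a + 1 - k) * (y (k + t + 1) - z * y (k + t))
        = z * ∑ k ∈ Finset.Icc b a, z ^ (a - k) * (y (k + t + 1) - z * y (k + t)) := by
      rw [Finset.mul_sum]
      refine Finset.sum_congr rfl fun k hk => ?_
      rw [Nat.sub_add_comm (Finset.mem_Icc.1 hk).2, pow_succ]
      ring
    have h2 : ((a + 1 : ℕ) : ℤ) + t = a + t + 1 := by push_cast; ring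
    rw [h1, h2, Nat.sub_add_comm hab, pow_succ z (a - b + 1), Nat.sub_self, pow_zero]
    linear_combination z * ih

theorem det_sum_columns {K ι α : Type*} [CommRing K] [Fintype ι] [DecidableEq ι]
    (s : ι → Finset α) (f : ι → α → ι → K) :
    Matrix.det (Matrix.of fun i j => ∑ k ∈ s j, f j k i) =
      ∑ r ∈ Fintype.piFinset s, Matrix.det (Matrix.of fun i j => f j (r j) i) := by
  have h := (Matrix.detRowAlternating (n := ι) (R := K)).toMultilinearMap.map_sum_finset
    (g := f) s
  have e1 : Matrix.det (Matrix.of fun i j => ∑ k ∈ s j, f j k i)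
      = Matrix.det (Matrix.of fun j i => ∑ k ∈ s j, f j k i) := by
    rw [← Matrix.det_transpose]; rfl
  have e2 : ∀ r : ι → α, Matrix.det (Matrix.of fun i j => f j (r j) i)
      = Matrix.det (Matrix.of fun j i => f j (r j) i) := fun r => by
    rw [← Matrix.det_transpose]; rfl
  simp only [e1, e2]
  refine Eq.trans (congrArg Matrix.det ?_) h
  ext j i
  simp

/-- Reversing the order of the columns reduces this to the version in which each column is corrected
by its predecessor; the sign of the reversal is a unit and cancels. -/
theorem det_eq_of_forall_col_eq_smul_add_succ {K : Type*} [CommRing K] {n : ℕ}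
    {A B : Matrix (Fin (n + 1)) (Fin (n + 1)) K} (c : Fin n → K)
    (hlast : ∀ i, A i (Fin.last n) = B i (Fin.last n))
    (h : ∀ i (j : Fin n), A i j.castSucc = B i j.castSucc + c j * A i j.succ) :
    A.det = B.det := by
  have key : (A.submatrix id Fin.revPerm).det = (B.submatrix id Fin.revPerm).det := by
    refine Matrix.det_eq_of_forall_col_eq_smul_add_pred (fun j => c j.rev) (fun i => ?_)
      fun i j => ?_
    · simpa using hlast i
    · simpa [Fin.rev_succ, Fin.rev_castSucc] using h i j.rev
  rw [Matrix.det_permute', Matrix.det_permute'] at key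
  have hu : IsUnit ((Equiv.Perm.sign (Fin.revPerm : Equiv.Perm (Fin (n + 1))) : ℤ) : K) :=
    ((Equiv.Perm.sign (Fin.revPerm : Equiv.Perm (Fin (n + 1)))).isUnit.map
      (Int.castRingHom K : ℤ →* K))
  exact hu.mul_left_cancel key

/-- First half of the branching rule: a horizontal strip is removed. -/
theorem det_horizontal_strip {K : Type*} [CommRing K] {n : ℕ} (y : ℤ → Fin (n + 1) → K) (z : K)
    {lam : ℕ → ℕ} (hlam : Antitone lam) (h0 : lam (n + 1) = 0) (hy : y 0 = 0) :
    Matrix.det (Matrix.of fun i (j : Fin (n + 1)) => y (lam j + (n - j) + 1) i) =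
      ∑ k ∈ Fintype.piFinset fun j : Fin (n + 1) => Finset.Icc (lam (j + 1)) (lam j),
        z ^ (∑ j : Fin (n + 1), (lam j - k j)) *
          Matrix.det (Matrix.of fun i (j : Fin (n + 1)) =>
            y (k j + (n - j) + 1) i - z * y (k j + (n - j)) i) := by
  have h1 : Matrix.det (Matrix.of fun i (j : Fin (n + 1)) => y (lam j + (n - j) + 1) i) =
      Matrix.det (Matrix.of fun i (j : Fin (n + 1)) =>
        ∑ k ∈ Finset.Icc (lam (j + 1)) (lam j), z ^ (lam j - k) *
          (y (k + (n - j) + 1) i - z * y (k + (n - j)) i)) := by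
    refine det_eq_of_forall_col_eq_smul_add_succ
      (fun j => z ^ (lam j - lam (j + 1) + 1)) (fun i => ?_) fun i j => ?_
    · simp only [Matrix.of_apply, Fin.val_last]
      -- The last column has no successor; its remainder is a multiple of y 0, which vanishes.
      rw [sum_Icc_telescope (fun c => y c i) z ((n : ℤ) - n) (hlam (Nat.le_succ n))]
      simp [h0, hy]
    · simp only [Matrix.of_apply, Fin.val_castSucc, Fin.val_succ]
      rw [sum_Icc_telescope (fun c => y c i) z ((n : ℤ) - j) (hlam (Nat.le_succ j))]
      congr 3
      push_cast
      ring
  rw [h1, det_sum_columns (fun j : Fin (n + 1) => Finset.Icc (lam (j + 1)) (lam j))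
    (fun j k i => z ^ (lam j - k) * (y (k + (n - j) + 1) i - z * y (k + (n - j)) i))]
  refine Finset.sum_congr rfl fun k _ => ?_
  rw [← Finset.prod_pow_eq_pow_sum]
  exact Matrix.det_mul_row (fun j : Fin (n + 1) => z ^ (lam j - k j)) (Matrix.of fun i
    (j : Fin (n + 1)) => y (k j + (n - j) + 1) i - z * y (k j + (n - j)) i)

/-- Second half of the branching rule: a horizontal strip and one variable are removed. -/
theorem det_horizontal_strip_of_first_row {K : Type*} [CommRing K] {n : ℕ}
    (g : ℤ → Fin (n + 1) → K) (y : ℤ → Fin n → K) (u : Fin n → K) (w q : K)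
    {kap : ℕ → ℕ} (hkap : Antitone kap)
    (hg0 : ∀ c : ℕ, g (c + 1) 0 = w ^ c * q)
    (hg : ∀ (c : ℤ) i, g (c + 1) (Fin.succ i) - w * g c (Fin.succ i) = u i * y c i) :
    Matrix.det (Matrix.of fun i (j : Fin (n + 1)) => g (kap j + (n - j) + 1) i) =
      (-1) ^ n * (w ^ kap n * q) * (∏ i, u i) *
        ∑ k ∈ Fintype.piFinset fun j : Fin n => Finset.Icc (kap (j + 1)) (kap j),
          w ^ (∑ j : Fin n, (kap j - k j)) *
            Matrix.det (Matrix.of fun i (j : Fin n) => y (k j + (n - j)) i) := by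
  have h1 : Matrix.det (Matrix.of fun i (j : Fin (n + 1)) => g (kap j + (n - j) + 1) i) =
      Matrix.det (Matrix.of fun i => (Fin.lastCases (g (kap n + 1) i) (fun j : Fin n =>
        ∑ k ∈ Finset.Icc (kap (j + 1)) (kap j), w ^ (kap j - k) *
          (g (k + (n - j) + 1) i - w * g (k + (n - j)) i)) : Fin (n + 1) → K)) := by
    refine det_eq_of_forall_col_eq_smul_add_succ
      (fun j => w ^ (kap j - kap (j + 1) + 1)) (fun i => ?_) fun i j => ?_
    · simp
    · simp only [Matrix.of_apply, Fin.val_castSucc, Fin.val_succ, Fin.lastCases_castSucc]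
      rw [sum_Icc_telescope (fun c => g c i) w ((n : ℤ) - j) (hkap (Nat.le_succ j))]
      congr 3
      push_cast
      ring
  -- Row 0 is geometric with ratio w, so the differences kill all its entries but the last;
  -- expansion along it leaves one minor and the sign (-1)^n.
  rw [h1, Matrix.det_succ_row_zero, Fin.sum_univ_castSucc, Finset.sum_eq_zero, zero_add]
  · have h2 : Matrix.submatrix (Matrix.of fun i => (Fin.lastCases (g (kap n + 1) i)
        (fun j : Fin n => ∑ k ∈ Finset.Icc (kap (j + 1)) (kap j), w ^ (kap j - k) *
          (g (k + (n - j) + 1) i - w * g (k + (n - j)) i)) : Fin (n + 1) → K))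
        Fin.succ (Fin.last n).succAbove =
        Matrix.of fun i j => u i * (Matrix.of fun i (j : Fin n) =>
          ∑ k ∈ Finset.Icc (kap (j + 1)) (kap j), w ^ (kap j - k) * y (k + (n - j)) i) i j := by
      ext i j
      simp only [Matrix.submatrix_apply, Matrix.of_apply, Fin.succAbove_last,
        Fin.lastCases_castSucc, hg, Finset.mul_sum]
      exact Finset.sum_congr rfl fun k _ => by ring
    rw [h2, Matrix.det_mul_column,
      det_sum_columns (fun j : Fin n => Finset.Icc (kap (j + 1)) (kap j))
        (fun j k i => w ^ (kap j - k) * y (k + (n - j)) i)]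
    simp only [Matrix.of_apply, Fin.lastCases_last, hg0, Fin.val_last]
    rw [mul_assoc _ (∏ i, u i)]
    congr 2
    refine Finset.sum_congr rfl fun k _ => ?_
    rw [← Finset.prod_pow_eq_pow_sum]
    exact Matrix.det_mul_row (fun j : Fin n => w ^ (kap j - k j))
      (Matrix.of fun i (j : Fin n) => y (k j + (n - j)) i)
  · intro j _
    simp only [Matrix.of_apply, Fin.lastCases_castSucc]
    rw [Finset.sum_eq_zero, mul_zero, zero_mul]
    intro k _
    have e : (k : ℤ) + (n - (j : ℕ)) = ((k + (n - 1 - j) : ℕ) : ℤ) + 1 := by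
      have := j.2; push_cast; omega
    have e' : (k : ℤ) + (n - (j : ℕ)) + 1 = ((k + (n - 1 - j) + 1 : ℕ) : ℤ) + 1 := by
      have := j.2; push_cast; omega
    rw [e', hg0, e, hg0]
    ring

/-! ### Symplectic characters and the Weyl character formula -/

/-- The odd Laurent polynomial `x ^ e - x ^ (-e)`. -/
def oddPow {K : Type*} [Field K] (x : K) (e : ℤ) : K := x ^ e - x ^ (-e)

/-- The symplectic Weyl denominator. -/
def symplecticDenom {K : Type*} [Field K] {n : ℕ} (x : Fin n → K) : K :=
  (∏ i, (x i - (x i)⁻¹)) *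
    ∏ i, ∏ j ∈ Finset.Ioi i, (x i + (x i)⁻¹ - x j - (x j)⁻¹)

/-- The symplectic character, defined by its branching rule. -/
def symplecticSum {K : Type*} [Field K] : (n : ℕ) → (Fin n → K) → (ℕ → ℕ) → K
  | 0, _, _ => 1
  | n + 1, x, lam =>
    ∑ k ∈ Fintype.piFinset fun i : Fin (n + 1) => Finset.Icc (lam (i + 1)) (lam i),
      x 0 ^ (∑ i : Fin (n + 1), (lam i - k i)) *
        ∑ v ∈ Fintype.piFinset fun i : Fin n => Finset.Icc (padded k (i + 1)) (padded k i),
          (x 0)⁻¹ ^ (∑ i : Fin (n + 1), (padded k i - padded v i)) *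
            symplecticSum n (fun i => x i.succ) (padded v)

theorem symplecticDenom_succ {K : Type*} [Field K] {n : ℕ} (x : Fin (n + 1) → K) :
    symplecticDenom x = (x 0 - (x 0)⁻¹) *
      (∏ i : Fin n, (x 0 + (x 0)⁻¹ - x i.succ - (x i.succ)⁻¹)) *
        symplecticDenom fun i => x i.succ := by
  unfold symplecticDenom
  rw [Fin.prod_univ_succ, Fin.prod_univ_succ (n := n) (f := fun i => ∏ j ∈ Finset.Ioi i, _),
    Fin.prod_Ioi_zero]
  simp only [Fin.prod_Ioi_succ]
  ring

/-- The Weyl character formula of the symplectic group for the characters defined by branching. -/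
theorem det_oddPow {K : Type*} [Field K] (n : ℕ) (x : Fin n → K) (hx : ∀ i, x i ≠ 0)
    (lam : ℕ → ℕ) (hlam : Antitone lam) (h0 : lam n = 0) :
    Matrix.det (Matrix.of fun i (j : Fin n) => oddPow (x i) (lam j + (n - j))) =
      symplecticDenom x * symplecticSum n x lam := by
  induction n generalizing lam with
  | zero => simp [symplecticDenom, symplecticSum]
  | succ n ih =>
    have hz : x 0 ≠ 0 := hx 0
    have e1 : (Matrix.of fun i (j : Fin (n + 1)) =>
        oddPow (x i) (lam j + ((n + 1 : ℕ) - j))) =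
        Matrix.of fun i (j : Fin (n + 1)) =>
          (fun e i => oddPow (x i) e : ℤ → Fin (n + 1) → K) (lam j + (n - j) + 1) i := by
      ext i j
      simp only [Matrix.of_apply]
      congr 1
      push_cast
      ring
    rw [e1, det_horizontal_strip (fun e i => oddPow (x i) e) (x 0) hlam h0 (by ext i; simp [oddPow]), symplecticSum,
      Finset.mul_sum]
    refine Finset.sum_congr rfl fun k hk => ?_
    have e2 : (Matrix.of fun i (j : Fin (n + 1)) =>
        (fun e i => oddPow (x i) e : ℤ → Fin (n + 1) → K) (k j + (n - j) + 1) i -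
          x 0 * (fun e i => oddPow (x i) e : ℤ → Fin (n + 1) → K) (k j + (n - j)) i) =
        Matrix.of fun i (j : Fin (n + 1)) =>
          (fun e i => oddPow (x i) e - x 0 * oddPow (x i) (e - 1) : ℤ → Fin (n + 1) → K)
            (padded k j + (n - j) + 1) i := by
      ext i j
      simp [padded_val]
    -- For `x 0` itself the differences from the first half are geometric with ratio `(x 0)⁻¹`. A
    -- second difference with that ratio acts on the other rows as multiplication by x + x⁻¹ - x_0 -
    -- x_0⁻¹, which supplies the factors of the Weyl denominator.
    rw [e2, det_horizontal_strip_of_first_row (kap := padded k)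
      (fun e i => oddPow (x i) e - x 0 * oddPow (x i) (e - 1)) (fun e i => oddPow (x i.succ) e)
      (fun i => -(x 0 + (x 0)⁻¹ - x i.succ - (x i.succ)⁻¹)) (x 0)⁻¹ (x 0 - (x 0)⁻¹)
      (antitone_padded_of_interlace hk)]
    · rw [symplecticDenom_succ, Finset.prod_neg, Finset.card_univ, Fintype.card_fin,
        Finset.mul_sum, Finset.mul_sum, Finset.mul_sum, Finset.mul_sum]
      refine Finset.sum_congr rfl fun v hv => ?_
      have h3 := ih (fun i => x i.succ) (fun i => hx _) (padded v)
        (antitone_padded_of_interlace hv) (padded_of_le v le_rfl)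
      simp only [padded_val] at h3
      rw [h3, Fin.sum_univ_castSucc (f := fun i : Fin (n + 1) => padded k i - padded v i)]
      simp only [Fin.val_castSucc, Fin.val_last, padded_val v, padded_of_le v le_rfl, pow_add,
        Nat.sub_zero]
      have hs : ((-1 : K) ^ n) * (-1) ^ n = 1 := by rw [← mul_pow]; simp
      linear_combination (x 0 ^ (∑ i : Fin (n + 1), (lam i - k i)) * (x 0)⁻¹ ^ padded k n *
        (x 0 - (x 0)⁻¹) * (∏ i : Fin n, (x 0 + (x 0)⁻¹ - x i.succ - (x i.succ)⁻¹)) *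
        (x 0)⁻¹ ^ (∑ j : Fin n, (padded k j - v j)) *
        (symplecticDenom (fun i => x i.succ) *
          symplecticSum n (fun i => x i.succ) (padded v))) * hs
    · intro c
      simp only [oddPow, add_sub_cancel_right, neg_add, zpow_add₀ hz, zpow_neg, zpow_one,
        zpow_natCast, inv_pow]
      field_simp
      ring
    · intro c i
      have hi := hx i.succ
      simp only [oddPow, add_sub_cancel_right, neg_add, neg_sub, zpow_add₀ hi, zpow_sub₀ hi,
        zpow_neg, zpow_one]
      field_simp
      ring

/-! ### Column-strict fillings and symplectic tableaux -/

/-- A column-strict plane partition with row lengths `lam` and entries at most `b i` in row `i`,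
given as a function vanishing outside its shape. -/
structure IsColumnStrictFilling (b lam : ℕ → ℕ) (f : ℕ → ℕ → ℕ) : Prop where
  support : ∀ i j, 0 < f i j ↔ j < lam i
  row : ∀ i j, f i (j + 1) ≤ f i j
  col : ∀ i j, 0 < f (i + 1) j → f (i + 1) j < f i j
  bound : ∀ i j, f i j ≤ b i

/-- A row-strict plane partition with row lengths `lam` and entries at most `b i` in row `i`,
given as a function vanishing outside its shape. -/
structure IsRowStrictFilling (b lam : ℕ → ℕ) (f : ℕ → ℕ → ℕ) : Prop where
  support : ∀ i j, 0 < f i j ↔ j < lam i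
  row : ∀ i j, 0 < f i (j + 1) → f i (j + 1) < f i j
  col : ∀ i j, f (i + 1) j ≤ f i j
  bound : ∀ i j, f i j ≤ b i

/-- Adds `1` to all entries in the cells of the shape with row lengths `lam`. -/
def addShape (lam : ℕ → ℕ) (f : ℕ → ℕ → ℕ) (i j : ℕ) : ℕ := f i j + if j < lam i then 1 else 0

theorem addShape_injective (lam : ℕ → ℕ) : Function.Injective (addShape lam) := fun f g h => by
  funext i j
  have := congrFun (congrFun h i) j
  simpa [addShape] using this

theorem eq_of_support {f : ℕ → ℕ → ℕ} {lam mu : ℕ → ℕ} (h : ∀ i j, 0 < f i j ↔ j < lam i)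
    (h' : ∀ i j, 0 < f i j ↔ j < mu i) : lam = mu := by
  funext i
  refine eq_of_forall_lt_iff fun j => ?_
  rw [← h, ← h']

/-- With c = 1 this gives the row lengths left after the ones are removed. -/
theorem exists_length_of_antitone {h : ℕ → ℕ} (hh : Antitone h) {N : ℕ} (hN : h N = 0) (c : ℕ) :
    ∃ k, ∀ j, j < k ↔ c < h j := by
  have hex : ∃ k, h k ≤ c := ⟨N, by omega⟩
  refine ⟨Nat.find hex, fun j => ?_⟩
  rw [Nat.lt_find_iff]
  exact ⟨fun H => not_le.1 (H j le_rfl), fun H m hm => not_le.2 (H.trans_le (hh hm))⟩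

theorem addShape_pred {f : ℕ → ℕ → ℕ} {lam : ℕ → ℕ} (h : ∀ i j, 0 < f i j ↔ j < lam i) :
    addShape lam (fun i j => f i j - 1) = f := by
  funext i j
  have := h i j
  simp only [addShape]
  split_ifs with hj
  · have := this.2 hj
    omega
  · have : ¬ 0 < f i j := fun H => hj (this.1 H)
    omega

theorem IsColumnStrictFilling.antitone {b lam : ℕ → ℕ} {f : ℕ → ℕ → ℕ}
    (h : IsColumnStrictFilling b lam f) : Antitone lam := by
  refine antitone_nat_of_succ_le fun i => le_of_forall_lt fun j hj => ?_
  have := (h.support (i + 1) j).2 hj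
  exact (h.support i j).1 (this.trans (h.col i j this))

theorem IsRowStrictFilling.antitone {b lam : ℕ → ℕ} {f : ℕ → ℕ → ℕ}
    (h : IsRowStrictFilling b lam f) : Antitone lam := by
  refine antitone_nat_of_succ_le fun i => le_of_forall_lt fun j hj => ?_
  have := (h.support (i + 1) j).2 hj
  exact (h.support i j).1 (this.trans_le (h.col i j))

/-- Removing the ones from a column-strict plane partition. -/
theorem setOf_isColumnStrictFilling_eq (m : ℕ) {b lam : ℕ → ℕ} (hm : ∀ i, m ≤ i → b i ≤ 1)
    (hlam : ∀ i, m < i → lam i = 0) (hb : ∀ i, b i = 0 → lam i = 0) :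
    {f | IsColumnStrictFilling b lam f} =
      ⋃ k ∈ ((Fintype.piFinset fun i : Fin m => Finset.Icc (lam (i + 1)) (lam i) :
        Finset (Fin m → ℕ)) : Set (Fin m → ℕ)),
        addShape lam '' {f | IsColumnStrictFilling (fun i => b i - 1) (padded k) f} := by
  ext f
  simp only [Set.mem_ofPred_eq, Set.mem_iUnion, Set.mem_image, exists_prop, Finset.mem_coe,
    Fintype.mem_piFinset, Finset.mem_Icc]
  constructor
  · intro h
    have hex : ∀ i, ∃ k, ∀ j, j < k ↔ 1 < f i j := fun i =>
      exists_length_of_antitone (antitone_nat_of_succ_le (h.row i)) (N := lam i)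
        (Nat.eq_zero_of_not_pos fun H => lt_irrefl _ ((h.support i _).1 H)) 1
    choose k hk using hex
    have hk0 : ∀ i, m ≤ i → k i = 0 := fun i hi => by
      by_contra H
      have h1 := (hk i 0).1 (Nat.pos_of_ne_zero H)
      have h2 := h.bound i 0
      have h3 := hm i hi
      omega
    have hpad := padded_restrict hk0
    refine ⟨fun i => k i, fun i => ⟨?_, ?_⟩, fun i j => f i j - 1, ⟨?_, ?_, ?_, ?_⟩,
      addShape_pred h.support⟩
    -- A cell with a cell below it contains more than 1 by column-strictness, so the ones form a
    -- horizontal strip.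
    · refine le_of_forall_lt fun j hj => (hk i j).2 ?_
      have h1 := (h.support (i + 1) j).2 hj
      have h2 := h.col i j h1
      omega
    · refine le_of_forall_lt fun j hj => (h.support i j).1 ?_
      have := (hk i j).1 hj
      omega
    · intro i j
      rw [hpad, hk]
      omega
    · intro i j
      have := h.row i j
      omega
    · intro i j hj
      have := h.col i j (by omega)
      omega
    · intro i j
      have := h.bound i j
      omega
  · rintro ⟨k, hk, f, hf, rfl⟩
    have hle : ∀ i, padded k i ≤ lam i := fun i => by
      by_cases hi : i < m
      · rw [padded_of_lt k hi]
        exact (hk ⟨i, hi⟩).2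
      · rw [padded_of_le k (not_lt.1 hi)]
        exact Nat.zero_le _
    have hge : ∀ i, lam (i + 1) ≤ padded k i := fun i => by
      by_cases hi : i < m
      · rw [padded_of_lt k hi]
        exact (hk ⟨i, hi⟩).1
      · rw [hlam (i + 1) (by omega)]
        exact Nat.zero_le _
    have hsup : ∀ i j, 0 < f i j → j < lam i := fun i j H =>
      ((hf.support i j).1 H).trans_le (hle i)
    refine ⟨fun i j => ?_, fun i j => ?_, fun i j => ?_, fun i j => ?_⟩ <;> unfold addShape
    · have := hsup i j
      split_ifs with hj
      · exact ⟨fun _ => hj, fun _ => by omega⟩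
      · exact ⟨fun H => absurd (this (by omega)) hj, fun H => absurd H hj⟩
    · have := hf.row i j
      split_ifs <;> omega
    · intro hpos
      have h1 : j < lam (i + 1) := by
        by_contra H
        have := hsup (i + 1) j
        rw [if_neg H] at hpos
        omega
      have h2 := (hf.support i j).2 (h1.trans_le (hge i))
      have h3 := hsup i j h2
      have h4 := hf.col i j
      simp only [h1, h3, if_true]
      omega
    · have h1 := hf.bound i j
      have h2 := hb i
      split_ifs <;> omega

/-- The weight `∏ omega (entry - 1)` over the cells of a filling. -/
def fillingWeight {K : Type*} [CommRing K] (omega : ℕ → K) (N : ℕ) (lam : ℕ → ℕ)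
    (f : ℕ → ℕ → ℕ) : K :=
  ∏ i ∈ Finset.range N, ∏ j ∈ Finset.range (lam i), omega (f i j - 1)

/-- The cells outside the inner shape contain 1 and have weight `omega 0`; in all others the letter
index shifts by one. -/
theorem fillingWeight_addShape {K : Type*} [CommRing K] (omega : ℕ → K) (N : ℕ)
    {b lam kap : ℕ → ℕ} {f : ℕ → ℕ → ℕ} (hf : IsColumnStrictFilling b kap f)
    (hle : ∀ i, kap i ≤ lam i) :
    fillingWeight omega N lam (addShape lam f) =
      omega 0 ^ (∑ i ∈ Finset.range N, (lam i - kap i)) *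
        fillingWeight (fun k => omega (k + 1)) N kap f := by
  unfold fillingWeight
  rw [← Finset.prod_pow_eq_pow_sum, ← Finset.prod_mul_distrib]
  refine Finset.prod_congr rfl fun i _ => ?_
  rw [← Finset.prod_range_mul_prod_Ico _ (hle i), mul_comm]
  congr 1
  · rw [← Nat.card_Ico, ← Finset.prod_const]
    refine Finset.prod_congr rfl fun j hj => ?_
    rw [Finset.mem_Ico] at hj
    have : ¬ 0 < f i j := fun H => absurd ((hf.support i j).1 H) (by omega)
    simp only [addShape, hj.2, if_true]
    congr 1
    omega
  · refine Finset.prod_congr rfl fun j hj => ?_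
    rw [Finset.mem_range] at hj
    have := (hf.support i j).2 hj
    simp only [addShape, hj.trans_le (hle i), if_true]
    congr 1
    omega

/-- The generating-function form of removing the ones. Used twice, for the letters x_0 and x_0⁻¹, it
gives one level of the recursion of `symplecticSum`. -/
theorem finsum_isColumnStrictFilling_step {K : Type*} [CommRing K] (omega : ℕ → K) (m N : ℕ)
    {b lam : ℕ → ℕ} (hm : ∀ i, m ≤ i → b i ≤ 1)
    (hlam : ∀ i, m < i → lam i = 0) (hb : ∀ i, b i = 0 → lam i = 0)
    (hfin : ∀ k ∈ Fintype.piFinset fun i : Fin m => Finset.Icc (lam (i + 1)) (lam i),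
      {f | IsColumnStrictFilling (fun i => b i - 1) (padded k) f}.Finite) :
    {f | IsColumnStrictFilling b lam f}.Finite ∧
    ∑ᶠ f ∈ {f | IsColumnStrictFilling b lam f}, fillingWeight omega N lam f =
      ∑ k ∈ Fintype.piFinset fun i : Fin m => Finset.Icc (lam (i + 1)) (lam i),
        omega 0 ^ (∑ i ∈ Finset.range N, (lam i - padded k i)) *
          ∑ᶠ f ∈ {f | IsColumnStrictFilling (fun i => b i - 1) (padded k) f},
            fillingWeight (fun k => omega (k + 1)) N (padded k) f := by
  rw [setOf_isColumnStrictFilling_eq m hm hlam hb]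
  refine ⟨(Finset.finite_toSet _).biUnion fun k hk => (hfin k hk).image _, ?_⟩
  rw [finsum_mem_biUnion _ (Finset.finite_toSet _) fun k hk => (hfin k hk).image _,
    finsum_mem_coe_finset]
  · refine Finset.sum_congr rfl fun k hk => ?_
    rw [finsum_mem_image (addShape_injective lam).injOn, mul_finsum_mem' _ _ (hfin k hk)]
    refine finsum_mem_congr rfl fun f hf => fillingWeight_addShape omega N hf fun i => ?_
    by_cases hi : i < m
    · rw [padded_of_lt k hi]
      exact (Finset.mem_Icc.1 (Fintype.mem_piFinset.1 hk ⟨i, hi⟩)).2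
    · rw [padded_of_le k (not_lt.1 hi)]
      exact Nat.zero_le _
  · intro k _ k' _ hne
    refine Set.disjoint_left.2 ?_
    rintro _ ⟨f, hf, rfl⟩ ⟨f', hf', he⟩
    have := addShape_injective lam he
    subst this
    exact hne (padded_injective (eq_of_support hf.support hf'.support))

/-- The weights of the entries `1, 2, 3, …` are `x 0, (x 0)⁻¹, x 1, …`. -/
def symplecticLetter {K : Type*} [Field K] {n : ℕ} (x : Fin n → K) (k : ℕ) : K :=
  if h : k / 2 < n then if k % 2 = 0 then x ⟨k / 2, h⟩ else (x ⟨k / 2, h⟩)⁻¹ else 1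

theorem symplecticLetter_add_two {K : Type*} [Field K] {n : ℕ} (x : Fin (n + 1) → K) :
    (fun k => symplecticLetter x (k + 1 + 1)) = symplecticLetter fun i => x i.succ := by
  funext k
  have h : (k + 1 + 1) / 2 = k / 2 + 1 := by omega
  have h' : (k + 1 + 1) % 2 = k % 2 := by omega
  simp [symplecticLetter, h, h']

/-- Symplectic characters are generating functions of symplectic tableaux. -/
theorem finsum_isColumnStrictFilling {K : Type*} [Field K] (n : ℕ) (x : Fin n → K)
    {lam : ℕ → ℕ} (hanti : Antitone lam) (h0 : ∀ i, n ≤ i → lam i = 0) :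
    {f | IsColumnStrictFilling (fun i => 2 * n - 2 * i) lam f}.Finite ∧
    ∑ᶠ f ∈ {f | IsColumnStrictFilling (fun i => 2 * n - 2 * i) lam f},
      fillingWeight (symplecticLetter x) n lam f = symplecticSum n x lam := by
  induction n generalizing lam with
  | zero =>
    have : {f | IsColumnStrictFilling (fun i => 2 * 0 - 2 * i) lam f} = {0} := by
      ext f
      simp only [Set.mem_ofPred_eq, Set.mem_singleton_iff]
      constructor
      · intro h
        funext i j
        simpa using h.bound i j
      · rintro rfl
        exact ⟨by simp [h0], by simp, by simp, by simp⟩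
    rw [this]
    refine ⟨Set.finite_singleton _, ?_⟩
    rw [finsum_mem_singleton]
    simp [fillingWeight, symplecticSum]
  | succ n ih =>
    have hbd : (fun i => 2 * (n + 1) - 2 * i - 1 - 1) = fun i => 2 * n - 2 * i := by
      funext i
      omega
    -- The original twos are now the ones. Row n has bound 1, so it disappears with them and n rows
    -- remain.
    have step : ∀ k ∈ Fintype.piFinset fun i : Fin (n + 1) => Finset.Icc (lam (i + 1)) (lam i),
        _ := fun k hk =>
      finsum_isColumnStrictFilling_step (fun k => symplecticLetter x (k + 1)) n (n + 1)
        (b := fun i => 2 * (n + 1) - 2 * i - 1) (lam := padded k) (fun i hi => by omega)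
        (fun i hi => padded_of_le k hi)
        (fun i hi => padded_of_le k (by omega)) (fun v hv => by
          rw [hbd]
          exact (ih (fun i => x i.succ) (antitone_padded_of_interlace hv)
            (fun i hi => padded_of_le v hi)).1)
    obtain ⟨hf, hs⟩ := finsum_isColumnStrictFilling_step (symplecticLetter x) (n + 1) (n + 1)
      (b := fun i => 2 * (n + 1) - 2 * i) (lam := lam) (fun i hi => by omega)
      (fun i hi => h0 i hi.le) (fun i hi => h0 i (by omega)) fun k hk => (step k hk).1
    refine ⟨hf, ?_⟩
    rw [hs, symplecticSum]
    refine Finset.sum_congr rfl fun k hk => ?_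
    rw [(step k hk).2, ← Fin.sum_univ_eq_sum_range (fun i => lam i - padded k i)]
    have hx0 : symplecticLetter x 0 = x 0 := by simp [symplecticLetter]
    have hx1 : symplecticLetter x (0 + 1) = (x 0)⁻¹ := by simp [symplecticLetter]
    simp only [padded_val k, hx0, hx1]
    congr 1
    · refine Finset.sum_congr rfl fun v hv => ?_
      have h := (ih (fun i => x i.succ) (antitone_padded_of_interlace hv)
            (fun i hi => padded_of_le v hi)).2
      rw [← h, ← Fin.sum_univ_eq_sum_range (fun i => padded k i - padded v i)]
      simp only [padded_val k]
      congr 1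
      rw [symplecticLetter_add_two, hbd]
      refine finsum_mem_congr rfl fun f _ => ?_
      rw [fillingWeight, Finset.prod_range_succ, padded_of_le v le_rfl]
      simp [fillingWeight]

/-! ### Row-strict fillings -/

/-- Removing the ones from a row-strict plane partition with entries at most `s + 1 - i` in
row `i`. -/
theorem setOf_isRowStrictFilling_succ (n s : ℕ) :
    {p : (Fin n → ℕ) × (ℕ → ℕ → ℕ) |
        IsRowStrictFilling (fun i => s + 1 - i) (padded p.1) p.2} =
      ⋃ p ∈ {p : (Fin n → ℕ) × (ℕ → ℕ → ℕ) |
          IsRowStrictFilling (fun i => s - i) (padded p.1) p.2},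
        (fun mu => (mu, addShape (padded mu) p.2)) ''
          {mu | mu ∈ (Fintype.piFinset fun i : Fin n =>
              if (i : ℕ) ≤ s then {p.1 i, p.1 i + 1} else {p.1 i}) ∧ Antitone mu} := by
  ext ⟨mu, f⟩
  simp only [Set.mem_ofPred_eq, Set.mem_iUnion, Set.mem_image, exists_prop, Fintype.mem_piFinset,
    Prod.mk.injEq, Prod.exists]
  constructor
  · intro h
    have hex : ∀ i, ∃ k, ∀ j, j < k ↔ 1 < f i j := fun i =>
      exists_length_of_antitone (antitone_nat_of_succ_le fun j => by
        have := h.row i j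
        omega) (N := padded mu i)
        (Nat.eq_zero_of_not_pos fun H => lt_irrefl _ ((h.support i _).1 H)) 1
    choose k hk using hex
    have hk0 : ∀ i, n ≤ i → k i = 0 := fun i hi => by
      by_contra H
      have h1 := (hk i 0).1 (Nat.pos_of_ne_zero H)
      have h2 := (h.support i 0).1 (by omega)
      rw [padded_of_le _ hi] at h2
      omega
    have hpad := padded_restrict hk0
    refine ⟨fun i => k i, fun i j => f i j - 1, ⟨?_, ?_, ?_, ?_⟩, mu, ⟨fun i => ?_, ?_⟩, rfl,
      addShape_pred h.support⟩
    · intro i j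
      rw [hpad, hk]
      omega
    · intro i j hj
      have := h.row i j (by omega)
      omega
    · intro i j
      have := h.col i j
      omega
    · intro i j
      have := h.bound i j
      omega
    · have h1 : k i ≤ mu i := le_of_forall_lt fun j hj => by
        have := (hk i j).1 hj
        rw [← padded_val mu i]
        exact (h.support i j).1 (by omega)
      -- A strictly decreasing row contains at most one 1.
      have h2 : mu i ≤ k i + 1 := by
        by_contra H
        have h3 := (h.support i (k i + 1)).2 (by rw [padded_val]; omega)
        have h4 := h.row i _ h3
        exact lt_irrefl _ ((hk i (k i)).2 (by omega))
      split_ifs with hi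
      · simp only [Finset.mem_insert, Finset.mem_singleton]
        omega
      -- For i > s the bound s + 1 - i is 0, so the row is empty.
      · have h3 : ¬ 0 < mu i := fun H => by
          rw [← padded_val mu i] at H
          have h4 := (h.support i 0).2 H
          have h5 := h.bound i 0
          omega
        simp only [Finset.mem_singleton]
        omega
    · intro i j hij
      rw [← padded_val mu, ← padded_val mu]
      exact h.antitone hij
  · rintro ⟨m, f, hf, mu, ⟨hmu, hanti⟩, rfl, rfl⟩
    have hle : ∀ i, padded m i ≤ padded mu i ∧ padded mu i ≤ padded m i + 1 ∧
        (¬ i ≤ s → padded mu i = padded m i) := fun i => by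
      by_cases hi : i < n
      · rw [padded_of_lt _ hi, padded_of_lt _ hi]
        have := hmu ⟨i, hi⟩
        split_ifs at this with h
        · simp only [Finset.mem_insert, Finset.mem_singleton] at this
          simp only at h
          omega
        · simp only [Finset.mem_singleton] at this
          omega
      · rw [padded_of_le _ (not_lt.1 hi), padded_of_le _ (not_lt.1 hi)]
        omega
    have hpanti : ∀ i, padded mu (i + 1) ≤ padded mu i := fun i => by
      by_cases hi : i + 1 < n
      · rw [padded_of_lt _ hi, padded_of_lt _ (by omega : i < n)]
        exact hanti (by simp)
      · rw [padded_of_le _ (not_lt.1 hi)]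
        exact Nat.zero_le _
    have hsup : ∀ i j, 0 < f i j → j < padded mu i := fun i j H =>
      ((hf.support i j).1 H).trans_le (hle i).1
    refine ⟨fun i j => ?_, fun i j => ?_, fun i j => ?_, fun i j => ?_⟩ <;> unfold addShape
    · have := hsup i j
      split_ifs with hj
      · exact ⟨fun _ => hj, fun _ => by omega⟩
      · exact ⟨fun H => absurd (this (by omega)) hj, fun H => absurd H hj⟩
    · intro hpos
      have h1 : j + 1 < padded mu i := by
        by_contra H
        have := hsup i (j + 1)
        rw [if_neg H] at hpos
        omega
      have h2 := (hf.support i j).2 (by have := hle i; omega)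
      have h3 := hf.row i j
      simp only [h1, (by omega : j < padded mu i), if_true]
      omega
    · have h1 := hf.col i j
      have h2 := hpanti i
      split_ifs <;> omega
    · have h1 := hf.bound i j
      have h2 := hle i
      split_ifs with hj
      · have : i ≤ s := by
          by_contra H
          rw [h2.2.2 H, ← hf.support] at hj
          omega
        omega
      · omega

/-! ### Expansion of the determinant over row-strict fillings -/

/-- The Laurent polynomial obtained from `x ^ e - x ^ (-e)` by `k` applications of the operator
adding the value at `e - 1` to the value at `e`. -/
def shiftedOddPow {K : Type*} [Field K] (x : K) (k : ℕ) (e : ℤ) : K :=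
  (1 + x⁻¹) ^ k * x ^ e - (1 + x) ^ k * x ^ (-e)

theorem shiftedOddPow_zero {K : Type*} [Field K] (x : K) (e : ℤ) :
    shiftedOddPow x 0 e = oddPow x e := by simp [shiftedOddPow, oddPow]

theorem shiftedOddPow_succ {K : Type*} [Field K] {x : K} (hx : x ≠ 0) (k : ℕ) (e : ℤ) :
    shiftedOddPow x (k + 1) e = shiftedOddPow x k e + shiftedOddPow x k (e - 1) := by
  simp only [shiftedOddPow, neg_sub, zpow_sub₀ hx, zpow_neg, zpow_one, pow_succ]
  field_simp
  ring

/-- The determinant attached to the complement of `mu` in the rectangle of width `l` when `r`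
steps of the expansion are left. -/
def shiftedDet {K : Type*} [Field K] {n : ℕ} (x : Fin n → K) (l R r : ℕ) (mu : Fin n → ℕ) : K :=
  Matrix.det (Matrix.of fun i (j : Fin n) =>
    shiftedOddPow (x i) (min (R - j) r) ((l : ℤ) - mu j + j + 1))

/-- Exactly the columns j ≤ s still have order r+1. Each splits in two, and lowering the exponent by
one amounts to raising `mu j` by one. -/
theorem shiftedDet_succ {K : Type*} [Field K] {n : ℕ} {x : Fin n → K} (hx : ∀ i, x i ≠ 0)
    (l : ℕ) {R r s : ℕ} (h : s + (r + 1) = R) (mu : Fin n → ℕ) :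
    shiftedDet x l R (r + 1) mu =
      ∑ m ∈ Fintype.piFinset fun i : Fin n =>
        if (i : ℕ) ≤ s then ({mu i, mu i + 1} : Finset ℕ) else {mu i}, shiftedDet x l R r m := by
  unfold shiftedDet
  rw [← det_sum_columns (fun i : Fin n =>
    if (i : ℕ) ≤ s then ({mu i, mu i + 1} : Finset ℕ) else {mu i})
    (fun j k i => shiftedOddPow (x i) (min (R - j) r) ((l : ℤ) - k + j + 1))]
  congr 1
  ext i j
  simp only [Matrix.of_apply]
  split_ifs with hj
  · rw [Finset.sum_pair (by omega), (by omega : min (R - (j : ℕ)) (r + 1) = r + 1),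
      (by omega : min (R - (j : ℕ)) r = r), shiftedOddPow_succ (hx i)]
    congr 2
    push_cast
    ring
  · rw [Finset.sum_singleton, (by omega : min (R - (j : ℕ)) (r + 1) = min (R - (j : ℕ)) r)]

/-- Parts grow by at most one, so monotonicity can fail only through m_{i+1} = m_i + 1 with i+1 ≤ s.
Then columns i and i+1 have the same exponent and the same order r. -/
theorem shiftedDet_eq_zero {K : Type*} [Field K] {n : ℕ} (x : Fin n → K)
    (l : ℕ) {R r s : ℕ} (h : s + (r + 1) = R) {mu m : Fin n → ℕ} (hmu : Antitone (padded mu))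
    (hm : m ∈ Fintype.piFinset fun i : Fin n =>
        if (i : ℕ) ≤ s then ({mu i, mu i + 1} : Finset ℕ) else {mu i}) (hna : ¬ Antitone m) :
    shiftedDet x l R r m = 0 := by
  obtain ⟨i, hi⟩ : ∃ i, padded m i < padded m (i + 1) := by
    by_contra! H
    refine hna fun i j hij => ?_
    rw [← padded_val m, ← padded_val m]
    exact antitone_nat_of_succ_le H hij
  have hin : i + 1 < n := by
    by_contra H
    rw [padded_of_le m (not_lt.1 H)] at hi
    omega
  have hmm := hmu (Nat.le_succ i)
  rw [Nat.succ_eq_add_one, padded_of_lt _ hin, padded_of_lt _ (by omega : i < n)] at hmm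
  rw [padded_of_lt _ hin, padded_of_lt _ (by omega : i < n)] at hi
  rw [Fintype.mem_piFinset] at hm
  have h1 := hm ⟨i, by omega⟩
  have h2 := hm ⟨i + 1, hin⟩
  have h3 : m ⟨i + 1, hin⟩ = m ⟨i, by omega⟩ + 1 ∧ i + 1 ≤ s := by
    split_ifs at h1 h2 with ha hb hb <;>
      simp only [Finset.mem_insert, Finset.mem_singleton] at h1 h2 ha hb <;> omega
  refine Matrix.det_zero_of_column_eq (i := ⟨i, by omega⟩) (j := ⟨i + 1, hin⟩)
    (by simp) fun k => ?_
  simp only [Matrix.of_apply, h3.1]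
  rw [(by omega : min (R - i) r = min (R - (i + 1)) r)]
  congr 1
  push_cast
  ring

/-- Expansion of the determinant over row-strict plane partitions. -/
theorem shiftedDet_eq_finsum {K : Type*} [Field K] {n : ℕ} {x : Fin n → K} (hx : ∀ i, x i ≠ 0)
    (l : ℕ) {R r s : ℕ} (h : s + r = R) :
    {p : (Fin n → ℕ) × (ℕ → ℕ → ℕ) |
        IsRowStrictFilling (fun i => s - i) (padded p.1) p.2}.Finite ∧
    shiftedDet x l R R 0 =
      ∑ᶠ p ∈ {p : (Fin n → ℕ) × (ℕ → ℕ → ℕ) |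
        IsRowStrictFilling (fun i => s - i) (padded p.1) p.2}, shiftedDet x l R r p.1 := by
  induction s generalizing r with
  | zero =>
    have : {p : (Fin n → ℕ) × (ℕ → ℕ → ℕ) |
        IsRowStrictFilling (fun i => 0 - i) (padded p.1) p.2} = {0} := by
      ext ⟨mu, f⟩
      simp only [Set.mem_ofPred_eq, Set.mem_singleton_iff]
      constructor
      · intro h
        have hf : f = 0 := by
          funext i j
          simpa using h.bound i j
        refine Prod.ext (funext fun i => ?_) hf
        have h0 := h.support i 0
        rw [padded_val] at h0
        simpa [hf] using h0
      · intro h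
        obtain ⟨rfl, rfl⟩ := Prod.mk.inj h
        exact ⟨by simp [padded], by simp, by simp, by simp⟩
    rw [this]
    refine ⟨Set.finite_singleton _, ?_⟩
    rw [finsum_mem_singleton, ← h, zero_add]
    rfl
  | succ s ih =>
    obtain ⟨hf, hs⟩ := ih (r := r + 1) (by omega)
    rw [setOf_isRowStrictFilling_succ]
    have hfin : ∀ p ∈ {p : (Fin n → ℕ) × (ℕ → ℕ → ℕ) |
          IsRowStrictFilling (fun i => s - i) (padded p.1) p.2},
        {mu | mu ∈ (Fintype.piFinset fun i : Fin n =>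
          if (i : ℕ) ≤ s then ({p.1 i, p.1 i + 1} : Finset ℕ) else {p.1 i}) ∧
            Antitone mu}.Finite := fun p _ =>
      (Finset.finite_toSet _).subset fun mu hmu => hmu.1
    refine ⟨hf.biUnion fun p hp => (hfin p hp).image _, ?_⟩
    rw [finsum_mem_biUnion _ hf fun p hp => (hfin p hp).image _, hs]
    · refine finsum_mem_congr rfl fun p hp => ?_
      rw [finsum_mem_image fun _ _ _ _ he => (Prod.mk.inj he).1,
        shiftedDet_succ hx l (s := s) (by omega)]
      classical
      -- Only antitone `m` are shapes of extended fillings; the other terms vanish.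
      rw [← Finset.sum_filter_of_ne (p := Antitone), ← finsum_mem_coe_finset]
      · refine finsum_mem_congr ?_ fun _ _ => rfl
        ext
        simp
      · intro m hm hne
        by_contra H
        exact hne (shiftedDet_eq_zero x l (s := s) (by omega) (IsRowStrictFilling.antitone hp)
          hm H)
    · intro p hp p' hp' hne
      refine Set.disjoint_left.2 ?_
      rintro _ ⟨mu, -, rfl⟩ ⟨mu', -, he⟩
      obtain ⟨rfl, he⟩ := Prod.mk.inj he
      have he := addShape_injective _ he
      refine hne (Prod.ext (padded_injective ?_) he.symm)
      exact eq_of_support hp.support (he ▸ hp'.support)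

/-! ### Complementary shapes and the combined expansion -/

/-- Row lengths of the complement, rotated by a half turn. -/
def complementLengths (l : ℕ) {n : ℕ} (mu : Fin n → ℕ) : ℕ → ℕ :=
  padded fun i : Fin n => l - mu i.rev

theorem antitone_complementLengths {n : ℕ} {mu : Fin n → ℕ} (l : ℕ) (hanti : Antitone mu) :
    Antitone (complementLengths l mu) := by
  refine antitone_nat_of_succ_le fun i => ?_
  unfold complementLengths
  by_cases hi : i + 1 < n
  · rw [padded_of_lt _ hi, padded_of_lt _ (by omega : i < n)]
    have : mu (Fin.rev ⟨i, by omega⟩) ≤ mu (Fin.rev ⟨i + 1, hi⟩) :=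
      hanti (Fin.rev_le_rev.2 (by simp))
    omega
  · rw [padded_of_le _ (not_lt.1 hi)]
    exact Nat.zero_le _

theorem antitone_of_padded {n : ℕ} {mu : Fin n → ℕ} (h : Antitone (padded mu)) : Antitone mu :=
  fun i j hij => by
    rw [← padded_val mu, ← padded_val mu]
    exact h hij

theorem IsRowStrictFilling.length_le {b lam : ℕ → ℕ} {f : ℕ → ℕ → ℕ}
    (h : IsRowStrictFilling b lam f) (i : ℕ) : lam i ≤ b i := by
  have key : ∀ j, j < lam i → f i j + j ≤ b i := fun j => by
    induction j with
    | zero => exact fun _ => h.bound i 0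
    | succ j ih =>
      intro hj
      have h1 := ih (by omega)
      have h2 := h.row i j ((h.support i _).2 hj)
      omega
  by_contra H
  have h1 := key (lam i - 1) (by omega)
  have h2 := (h.support i (lam i - 1)).2 (by omega)
  omega

theorem isUnit_sign_revPerm (K : Type*) [CommRing K] (n : ℕ) :
    IsUnit ((Equiv.Perm.sign (Fin.revPerm : Equiv.Perm (Fin n)) : ℤ) : K) :=
  (Equiv.Perm.sign (Fin.revPerm : Equiv.Perm (Fin n))).isUnit.map (Int.castRingHom K : ℤ →* K)

/-- Reversing the columns turns the exponents l - mu_j + j + 1 into those of the Weyl numerator for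
the complement. -/
theorem shiftedDet_zero {K : Type*} [Field K] {n : ℕ} {x : Fin n → K} (hx : ∀ i, x i ≠ 0)
    {l : ℕ} (R : ℕ) {mu : Fin n → ℕ} (hanti : Antitone mu) (hle : ∀ i, mu i ≤ l) :
    shiftedDet x l R 0 mu =
      ((Equiv.Perm.sign (Fin.revPerm : Equiv.Perm (Fin n)) : ℤ) : K) *
        (symplecticDenom x * symplecticSum n x (complementLengths l mu)) := by
  rw [← det_oddPow n x hx (complementLengths l mu) ?_ (padded_of_le _ le_rfl), ← Matrix.det_permute']
  · unfold shiftedDet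
    congr 1
    ext i j
    simp only [Matrix.of_apply, Nat.min_zero, shiftedOddPow_zero, Matrix.submatrix_apply, id,
      Fin.revPerm_apply, complementLengths, padded_val, Fin.rev_rev]
    congr 1
    have := hle j
    have := j.2
    rw [Fin.val_rev]
    omega
  · exact antitone_complementLengths l hanti

/-- The pairs of fillings indexing the expansion; the shapes of the two fillings are
complementary in a rectangle of width `l`. -/
def fillingPairs (n l R : ℕ) : Set (((Fin n → ℕ) × (ℕ → ℕ → ℕ)) × (ℕ → ℕ → ℕ)) :=
  {q | IsRowStrictFilling (fun i => R - i) (padded q.1.1) q.1.2 ∧ (∀ i, q.1.1 i ≤ l) ∧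
    IsColumnStrictFilling (fun i => 2 * n - 2 * i) (complementLengths l q.1.1) q.2}

/-- The offset ε is 0 in the odd case and 1 in the even case. After the columns are reversed, column
j has order R - j and exponent l + j + 1, the starting point of the expansion. -/
theorem det_shiftedOddPow {K : Type*} [Field K] {n : ℕ} {x : Fin n → K} (hx : ∀ i, x i ≠ 0)
    {l R ε : ℕ} (hR : R + 1 = n + ε) (hl : R ≤ l + 1) :
    (fillingPairs n l R).Finite ∧
    Matrix.det (Matrix.of fun i (j : Fin n) =>
      shiftedOddPow (x i) (j + ε) ((l : ℤ) + n - j)) =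
      symplecticDenom x * ∑ᶠ q ∈ fillingPairs n l R,
        fillingWeight (symplecticLetter x) n (complementLengths l q.1.1) q.2 := by
  obtain ⟨hfin, hsum⟩ := shiftedDet_eq_finsum hx l (add_zero R)
  have hpairs : fillingPairs n l R = ⋃ p ∈ {p : (Fin n → ℕ) × (ℕ → ℕ → ℕ) |
      IsRowStrictFilling (fun i => R - i) (padded p.1) p.2 ∧ ∀ i, p.1 i ≤ l},
      (fun f => (p, f)) '' {f | IsColumnStrictFilling (fun i => 2 * n - 2 * i)
        (complementLengths l p.1) f} := by
    ext ⟨p, f⟩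
    simp only [fillingPairs, Set.mem_ofPred_eq, Set.mem_iUnion, Set.mem_image, exists_prop,
      Prod.mk.injEq]
    constructor
    · rintro ⟨h1, h2, h3⟩
      exact ⟨p, ⟨h1, h2⟩, f, h3, rfl, rfl⟩
    · rintro ⟨p, ⟨h1, h2⟩, f, h3, rfl, rfl⟩
      exact ⟨h1, h2, h3⟩
  have hfin' : {p : (Fin n → ℕ) × (ℕ → ℕ → ℕ) |
      IsRowStrictFilling (fun i => R - i) (padded p.1) p.2 ∧ ∀ i, p.1 i ≤ l}.Finite :=
    hfin.subset fun p hp => hp.1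
  have hcol : ∀ p ∈ {p : (Fin n → ℕ) × (ℕ → ℕ → ℕ) |
      IsRowStrictFilling (fun i => R - i) (padded p.1) p.2 ∧ ∀ i, p.1 i ≤ l}, _ := fun p hp =>
    finsum_isColumnStrictFilling n x
      (antitone_complementLengths l (antitone_of_padded hp.1.antitone))
      fun i hi => padded_of_le _ hi
  rw [hpairs]
  refine ⟨hfin'.biUnion fun p hp => (hcol p hp).1.image _, ?_⟩
  rw [finsum_mem_biUnion _ hfin' fun p hp => (hcol p hp).1.image _]
  · refine (isUnit_sign_revPerm K n).mul_left_cancel ?_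
    rw [← Matrix.det_permute', mul_finsum_mem' _ _ hfin', mul_finsum_mem' _ _ hfin']
    have h1 : (Matrix.of fun i (j : Fin n) =>
        shiftedOddPow (x i) (j + ε) ((l : ℤ) + n - j)).submatrix id Fin.revPerm =
        Matrix.of fun i (j : Fin n) => shiftedOddPow (x i) (min (R - j) R)
          ((l : ℤ) - (0 : Fin n → ℕ) j + j + 1) := by
      ext i j
      have := j.2
      simp only [Matrix.of_apply, Matrix.submatrix_apply, id, Fin.revPerm_apply, Fin.val_rev]
      congr 1
      · omega
      · simp only [Pi.zero_apply]
        omega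
    rw [h1]
    refine hsum.trans ?_
    -- Fillings not fitting into width l drop out: row-strictness gives mu_0 ≤ R ≤ l + 1, so mu_0 =
    -- l + 1, and column 0 consists of `oddPow` at exponent 0.
    refine (finsum_mem_inter_support_eq' _ _ _ ?_).trans (finsum_mem_congr rfl ?_)
    · intro p hp
      refine ⟨fun h => ⟨h, ?_⟩, fun h => h.1⟩
      by_contra! H
      obtain ⟨i, hi⟩ := H
      refine hp ?_
      have h0 : 0 < n := i.pos
      have h2 := h.length_le 0
      have h3 := h.antitone (Nat.zero_le i)
      rw [padded_val] at h3
      rw [padded_of_lt _ h0] at h2 h3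
      refine Matrix.det_eq_zero_of_column_eq_zero ⟨0, h0⟩ fun k => ?_
      simp only [Matrix.of_apply, Nat.min_zero, shiftedOddPow_zero]
      rw [(by omega : p.1 ⟨0, h0⟩ = l + 1)]
      simp [oddPow]
    · intro p hp
      rw [shiftedDet_zero hx R (antitone_of_padded hp.1.antitone) hp.2,
        finsum_mem_image fun _ _ _ _ he => (Prod.mk.inj he).2, (hcol p hp).2]
  · intro p hp p' hp' hne
    refine Set.disjoint_left.2 ?_
    rintro _ ⟨f, -, rfl⟩ ⟨f', -, he⟩
    exact hne (Prod.mk.inj he).1.symm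

/-! ### The Littlewood-type quotient -/

theorem prod_prod_Ioi_mul {K : Type*} [CommRing K] {n : ℕ} (x : Fin n → K) :
    (∏ i, ∏ j ∈ Finset.Ioi i, x i * x j) * ∏ i, x i = ∏ i, x i ^ n := by
  induction n with
  | zero => simp
  | succ n ih =>
    rw [Fin.prod_univ_succ (f := fun i => ∏ j ∈ Finset.Ioi i, _), Fin.prod_Ioi_zero,
      Fin.prod_univ_succ (f := x), Fin.prod_univ_succ (f := fun i => x i ^ (n + 1))]
    simp only [Fin.prod_Ioi_succ]
    rw [Finset.prod_mul_distrib, Finset.prod_const, Finset.card_univ, Fintype.card_fin]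
    have h : ∏ i : Fin n, x i.succ ^ (n + 1) = (∏ i : Fin n, x i.succ ^ n) * ∏ i : Fin n, x i.succ := by
      simp only [pow_succ, Finset.prod_mul_distrib]
    rw [h, ← ih fun i => x i.succ]
    ring

theorem neg_one_pow_eq_prod {K : Type*} [CommRing K] (n : ℕ) :
    (-1 : K) ^ n = ∏ _i : Fin n, (-1) := by simp

/-- Factorwise, (1 - x_i x_j)(x_j - x_i) is x_i x_j times the Weyl factor of the pair, and (x_i -
x_i⁻¹) x_i = -(1 - x_i)(1 + x_i). The powers of x_i are balanced by `prod_prod_Ioi_mul`. -/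
theorem symplecticDenom_mul {K : Type*} [Field K] {n : ℕ} {x : Fin n → K} (hx : ∀ i, x i ≠ 0)
    (l : ℕ) :
    (-1) ^ n * (∏ i, x i ^ (l + n)) * symplecticDenom x =
      ((∏ i, (1 - x i)) * ∏ i, ∏ j ∈ Finset.Ioi i, (1 - x i * x j) * (x j - x i)) *
        ∏ i, (x i ^ l * (1 + x i)) := by
  have h1 : ∏ i, ∏ j ∈ Finset.Ioi i, (1 - x i * x j) * (x j - x i) =
      (∏ i, ∏ j ∈ Finset.Ioi i, x i * x j) *
        ∏ i, ∏ j ∈ Finset.Ioi i, (x i + (x i)⁻¹ - x j - (x j)⁻¹) := by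
    simp only [← Finset.prod_mul_distrib]
    refine Finset.prod_congr rfl fun i _ => Finset.prod_congr rfl fun j _ => ?_
    have hi := hx i
    have hj := hx j
    field_simp
    ring
  have h2 : (-1) ^ n * ∏ i, (x i - (x i)⁻¹) * x i = ∏ i, (1 - x i) * (1 + x i) := by
    rw [neg_one_pow_eq_prod, ← Finset.prod_mul_distrib]
    refine Finset.prod_congr rfl fun i _ => ?_
    have hi := hx i
    field_simp
    ring
  refine mul_right_cancel₀ (Finset.prod_ne_zero_iff.2 fun i (_ : i ∈ Finset.univ) => hx i) ?_
  have h3 := prod_prod_Ioi_mul x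
  rw [h1, symplecticDenom]
  simp only [Finset.prod_mul_distrib, pow_add] at h2 h3 ⊢
  rw [← h3]
  linear_combination (∏ i, x i ^ l) * (∏ i, ∏ j ∈ Finset.Ioi i, x i) *
    (∏ i, ∏ j ∈ Finset.Ioi i, x j) * (∏ i, x i) *
    (∏ i, ∏ j ∈ Finset.Ioi i, (x i + (x i)⁻¹ - x j - (x j)⁻¹)) * h2

/-- The genericity conditions under which the Littlewood-type quotient is defined. -/
structure IsGeneric {K : Type*} [Field K] {n : ℕ} (x : Fin n → K) : Prop where
  ne_zero : ∀ i, x i ≠ 0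
  one_add_ne_zero : ∀ i, 1 + x i ≠ 0
  denom_ne_zero :
    (∏ i, (1 - x i)) * ∏ i, ∏ j ∈ Finset.Ioi i, (1 - x i * x j) * (x j - x i) ≠ 0

theorem littlewoodRHS_odd {K : Type*} [Field K] {n l : ℕ} {x : Fin n → K} (hx : IsGeneric x)
    (hn : 1 ≤ n) (hl : n ≤ l + 2) :
    (fillingPairs n l (n - 1)).Finite ∧
    littlewoodRHS n (2 * l + 1) 0 x =
      (∏ i, x i ^ l * ((x i)⁻¹ + 1 + x i) * (1 + x i)) * ∑ᶠ q ∈ fillingPairs n l (n - 1),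
        fillingWeight (symplecticLetter x) n (complementLengths l q.1.1) q.2 := by
  obtain ⟨hf, hdet⟩ := det_shiftedOddPow hx.ne_zero (l := l) (R := n - 1) (ε := 0)
    (by omega) (by omega)
  refine ⟨hf, ?_⟩
  -- Each row has the common factor -x_i^(l+n).
  have hM : Matrix.det (Matrix.of fun i j : Fin n =>
      x i ^ (j : ℕ) * (1 + x i) ^ (j : ℕ) * (1 + 0 * x i) ^ (n - 1 - (j : ℕ))
        - x i ^ (2 * l + 1 + 2 * n - ((j : ℕ) + 1)) * (1 + (x i)⁻¹) ^ (j : ℕ)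
            * (1 + 0 * (x i)⁻¹) ^ (n - 1 - (j : ℕ))) =
      (-1) ^ n * (∏ i, x i ^ (l + n)) * Matrix.det (Matrix.of fun i (j : Fin n) =>
      shiftedOddPow (x i) (j + 0) ((l : ℤ) + n - j)) := by
    rw [neg_one_pow_eq_prod, ← Finset.prod_mul_distrib, ← Matrix.det_mul_column]
    congr 1
    ext i j
    have hi := hx.ne_zero i
    have e1 : x i ^ (2 * l + 1 + 2 * n - ((j : ℕ) + 1)) =
        x i ^ (l + n) * x i ^ ((l : ℤ) + n - j) := by
      rw [← zpow_natCast, ← zpow_natCast, ← zpow_add₀ hi]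
      congr 1
      have := j.2
      omega
    have e2 : x i ^ (j : ℕ) = x i ^ (l + n) * x i ^ (-((l : ℤ) + n - j)) := by
      rw [← zpow_natCast, ← zpow_natCast, ← zpow_add₀ hi]
      congr 1
      push_cast
      ring
    simp only [Matrix.of_apply, shiftedOddPow, e1, e2, add_zero, zero_mul, one_pow, mul_one]
    ring
  rw [littlewoodRHS, hM, hdet, ← mul_assoc, symplecticDenom_mul hx.ne_zero, mul_assoc (_ * _),
    mul_div_cancel_left₀ _ hx.denom_ne_zero, ← mul_assoc, ← Finset.prod_mul_distrib]
  congr 1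
  exact Finset.prod_congr rfl fun i _ => by ring

theorem littlewoodRHS_even {K : Type*} [Field K] {n l : ℕ} {x : Fin n → K} (hx : IsGeneric x)
    (hl : n ≤ l + 1) :
    (fillingPairs n l n).Finite ∧
    littlewoodRHS n (2 * l) 0 x =
      (∏ i, x i ^ l * ((x i)⁻¹ + 1 + x i)) * ∑ᶠ q ∈ fillingPairs n l n,
        fillingWeight (symplecticLetter x) n (complementLengths l q.1.1) q.2 := by
  obtain ⟨hf, hdet⟩ := det_shiftedOddPow hx.ne_zero (l := l) (R := n) (ε := 1) rfl hl
  refine ⟨hf, ?_⟩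
  -- Since 1 + x = x(1 + x⁻¹), multiplying row i by 1 + x_i raises both binomial exponents to j+1
  -- and restores the symmetry of the powers of x_i.
  have hM : (∏ i, (1 + x i)) * Matrix.det (Matrix.of fun i j : Fin n =>
      x i ^ (j : ℕ) * (1 + x i) ^ (j : ℕ) * (1 + 0 * x i) ^ (n - 1 - (j : ℕ))
        - x i ^ (2 * l + 2 * n - ((j : ℕ) + 1)) * (1 + (x i)⁻¹) ^ (j : ℕ)
            * (1 + 0 * (x i)⁻¹) ^ (n - 1 - (j : ℕ))) =
      (-1) ^ n * (∏ i, x i ^ (l + n)) * Matrix.det (Matrix.of fun i (j : Fin n) =>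
      shiftedOddPow (x i) (j + 1) ((l : ℤ) + n - j)) := by
    rw [neg_one_pow_eq_prod, ← Finset.prod_mul_distrib, ← Matrix.det_mul_column,
      ← Matrix.det_mul_column]
    congr 1
    ext i j
    have hi := hx.ne_zero i
    have e1 : x i ^ (l + n) * x i ^ ((l : ℤ) + n - j) =
        x i ^ (2 * l + 2 * n - ((j : ℕ) + 1)) * x i := by
      rw [← pow_succ, ← zpow_natCast, ← zpow_natCast, ← zpow_add₀ hi]
      congr 1
      have := j.2
      omega
    have e2 : x i ^ (j : ℕ) = x i ^ (l + n) * x i ^ (-((l : ℤ) + n - j)) := by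
      rw [← zpow_natCast, ← zpow_natCast, ← zpow_add₀ hi]
      congr 1
      push_cast
      ring
    have e3 : x i * (1 + (x i)⁻¹) = 1 + x i := by
      field_simp
      ring
    simp only [Matrix.of_apply, shiftedOddPow, e2, zero_mul, add_zero, one_pow, mul_one]
    linear_combination (1 + (x i)⁻¹) ^ ((j : ℕ) + 1) * e1 + x i ^ (2 * l + 2 * n - ((j : ℕ) + 1)) *
      (1 + (x i)⁻¹) ^ (j : ℕ) * e3
  have hp : ∏ i, (1 + x i) ≠ 0 := Finset.prod_ne_zero_iff.2 fun i _ => hx.one_add_ne_zero i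
  rw [hdet, ← mul_assoc, symplecticDenom_mul hx.ne_zero] at hM
  rw [littlewoodRHS, Finset.prod_mul_distrib, mul_comm (∏ i, x i ^ l), mul_assoc]
  simp only [add_zero]
  congr 1
  rw [div_eq_iff hx.denom_ne_zero]
  refine mul_left_cancel₀ hp (hM.trans ?_)
  rw [Finset.prod_mul_distrib]
  ring

/-! ### Genericity of the indeterminates -/

theorem isGeneric_indet (n : ℕ) : IsGeneric (indet n) := by
  have hinj : Function.Injective (algebraMap (MvPolynomial (Fin n) ℤ)
    (FractionRing (MvPolynomial (Fin n) ℤ))) := IsFractionRing.injective _ _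
  -- A polynomial is nonzero in the fraction field once it has a nonzero value at one integer point.
  have key : ∀ p : MvPolynomial (Fin n) ℤ, ∀ v : Fin n → ℤ, MvPolynomial.eval v p ≠ 0 →
      algebraMap _ (FractionRing (MvPolynomial (Fin n) ℤ)) p ≠ 0 := by
    intro p v hv h
    rw [← map_zero (algebraMap (MvPolynomial (Fin n) ℤ) _)] at h
    rw [hinj h, map_zero] at hv
    exact hv rfl
  refine ⟨fun i => ?_, fun i => ?_, ?_⟩
  · exact key (MvPolynomial.X i) (fun _ => 1) (by simp)
  · have := key (1 + MvPolynomial.X i) (fun _ => 0) (by simp)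
    simpa [indet] using this
  · refine mul_ne_zero (Finset.prod_ne_zero_iff.2 fun i _ => ?_)
      (Finset.prod_ne_zero_iff.2 fun i _ => Finset.prod_ne_zero_iff.2 fun j hj =>
        mul_ne_zero ?_ ?_)
    · have := key (1 - MvPolynomial.X i) (fun _ => 0) (by simp)
      simpa [indet] using this
    · have := key (1 - MvPolynomial.X i * MvPolynomial.X j) (fun _ => 0) (by simp)
      simpa [indet] using this
    · have := key (MvPolynomial.X j - MvPolynomial.X i) (fun k => k) (by
        have := Finset.mem_Ioi.1 hj
        simp [sub_eq_zero]
        omega)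
      simpa [indet] using this

/-! ### Weights of plane partitions, and Young diagrams in a rectangle -/

theorem prod_range_two_mul {K : Type*} [CommMonoid K] (F : ℕ → K) (n : ℕ) :
    ∏ k ∈ Finset.range (2 * n), F k = ∏ i ∈ Finset.range n, F (2 * i) * F (2 * i + 1) := by
  induction n with
  | zero => simp
  | succ n ih =>
    rw [Finset.prod_range_succ, ← ih, (by ring : 2 * (n + 1) = 2 * n + 1 + 1),
      Finset.prod_range_succ, Finset.prod_range_succ, mul_assoc]

theorem entryWeight_eq_fillingWeight {K : Type*} [Field K] {n : ℕ} (x : Fin n → K)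
    {S : Finset (ℕ × ℕ)} (P : PlanePartition S) {lam : ℕ → ℕ}
    (hS : ∀ i j, (i, j) ∈ S ↔ j < lam i) (hlam : ∀ i, n ≤ i → lam i = 0)
    (hP : P.RowBounded fun i => 2 * n - 2 * i) :
    entryWeight x P = fillingWeight (symplecticLetter x) n lam P.entry := by
  have h1 : fillingWeight (symplecticLetter x) n lam P.entry =
      ∏ c ∈ S, symplecticLetter x (P.entry c.1 c.2 - 1) := by
    rw [fillingWeight, ← Finset.prod_finset_product' S]
    rintro ⟨i, j⟩
    simp only [hS, Finset.mem_range]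
    refine ⟨fun h => ⟨?_, h⟩, fun h => h.2⟩
    by_contra H
    rw [hlam i (not_lt.1 H)] at h
    omega
  have hmaps : ∀ c ∈ S, P.entry c.1 c.2 - 1 ∈ Finset.range (2 * n) := fun c hc => by
    have h2 := P.pos c.1 c.2 hc
    have h3 := hP c.1 c.2 hc
    simp only at h3
    rw [Finset.mem_range]
    omega
  -- The cells are grouped by letter; letters 2i and 2i+1 are the entries 2i+1 and 2i+2, with
  -- weights x_i and x_i⁻¹.
  rw [h1, ← Finset.prod_fiberwise_of_maps_to hmaps, prod_range_two_mul,
    ← Fin.prod_univ_eq_prod_range (fun i =>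
      (∏ c ∈ S with P.entry c.1 c.2 - 1 = 2 * i, symplecticLetter x (P.entry c.1 c.2 - 1)) *
      ∏ c ∈ S with P.entry c.1 c.2 - 1 = 2 * i + 1, symplecticLetter x (P.entry c.1 c.2 - 1))]
  have h4 : ∀ k, ∏ c ∈ S with P.entry c.1 c.2 - 1 = k,
      symplecticLetter x (P.entry c.1 c.2 - 1) = symplecticLetter x k ^ P.count (k + 1) := by
    intro k
    rw [PlanePartition.count, ← Finset.prod_const]
    refine Finset.prod_congr ?_ fun c hc => ?_
    · refine Finset.filter_congr fun c hc => ?_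
      have := P.pos c.1 c.2 hc
      omega
    · rw [(Finset.mem_filter.1 hc).2, Nat.add_sub_cancel]
  unfold entryWeight
  refine Finset.prod_congr rfl fun i _ => ?_
  have h5 : (2 * (i : ℕ) + 1) / 2 = i := by omega
  rw [h4, h4]
  simp [symplecticLetter, h5, Nat.add_mod]

theorem mem_rectangle {n l i j : ℕ} : (i, j) ∈ rectangle n l ↔ i < n ∧ j < l := by
  simp [rectangle]

theorem mem_cells_iff_lt_rowLen (D : YoungDiagram) (i j : ℕ) :
    (i, j) ∈ D.cells ↔ j < D.rowLen i := by
  rw [YoungDiagram.mem_cells, YoungDiagram.mem_iff_lt_rowLen]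

theorem YoungDiagram.rowLen_le_of_subset_rectangle {D : YoungDiagram} {n l : ℕ}
    (h : D.cells ⊆ rectangle n l) (i : ℕ) : D.rowLen i ≤ l :=
  le_of_forall_lt fun j hj =>
    (mem_rectangle.1 (h ((mem_cells_iff_lt_rowLen D i j).2 hj))).2

theorem YoungDiagram.rowLen_eq_zero_of_subset_rectangle {D : YoungDiagram} {n l : ℕ}
    (h : D.cells ⊆ rectangle n l) {i : ℕ} (hi : n ≤ i) : D.rowLen i = 0 := by
  by_contra H
  have := mem_rectangle.1 (h ((mem_cells_iff_lt_rowLen D i 0).2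
    (Nat.pos_of_ne_zero H)))
  omega

/-- Row lengths of the rotated complement of a Young diagram in the `n × l` rectangle. -/
def complementRows (n l : ℕ) (D : YoungDiagram) (i : Fin n) : ℕ := l - D.rowLen i.rev

theorem mem_complementShape {n l : ℕ} {D : YoungDiagram} {i j : ℕ} :
    (i, j) ∈ complementShape n l D ↔ j < padded (complementRows n l D) i := by
  simp only [complementShape, Finset.mem_filter, mem_rectangle, YoungDiagram.mem_iff_lt_rowLen]
  by_cases hi : i < n
  · rw [padded_of_lt _ hi, complementRows, Fin.val_rev]
    simp only [(by omega : n - (i + 1) = n - 1 - i)]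
    omega
  · rw [padded_of_le _ (not_lt.1 hi)]
    omega

theorem complementLengths_complementRows {n l : ℕ} {D : YoungDiagram}
    (h : D.cells ⊆ rectangle n l) : complementLengths l (complementRows n l D) = D.rowLen := by
  rw [← padded_restrict fun i => YoungDiagram.rowLen_eq_zero_of_subset_rectangle h (i := i)]
  unfold complementLengths complementRows
  congr 1
  funext i
  have := YoungDiagram.rowLen_le_of_subset_rectangle h i
  rw [Fin.rev_rev]
  omega

theorem antitone_complementRows (n l : ℕ) (D : YoungDiagram) :
    Antitone (complementRows n l D) := fun i j hij => by
  have : D.rowLen i.rev ≤ D.rowLen j.rev := D.rowLen_anti _ _ (Fin.rev_le_rev.2 hij)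
  unfold complementRows
  omega

/-- The Young diagram with given row lengths inside the `n × l` rectangle. -/
def diagramOfRows (n l : ℕ) {lam : ℕ → ℕ} (hlam : Antitone lam) : YoungDiagram where
  cells := (rectangle n l).filter fun c => c.2 < lam c.1
  isLowerSet := by
    rintro ⟨i, j⟩ ⟨i', j'⟩ ⟨hi, hj⟩ h
    simp only [Finset.coe_filter, Set.mem_ofPred_eq, mem_rectangle] at h hi hj ⊢
    have := hlam hi
    omega

theorem rowLen_diagramOfRows {n l : ℕ} {lam : ℕ → ℕ} (hlam : Antitone lam)
    (h0 : ∀ i, n ≤ i → lam i = 0) (hl : ∀ i, lam i ≤ l) :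
    (diagramOfRows n l hlam).rowLen = lam := by
  funext i
  refine eq_of_forall_lt_iff fun j => ?_
  rw [← YoungDiagram.mem_iff_lt_rowLen, ← YoungDiagram.mem_cells]
  simp only [diagramOfRows, Finset.mem_filter, mem_rectangle]
  have := hl i
  have := h0 i
  omega

theorem complementRows_diagramOfRows {n l : ℕ} {mu : Fin n → ℕ} (hmu : Antitone mu)
    (hl : ∀ i, mu i ≤ l) :
    complementRows n l (diagramOfRows n l (antitone_complementLengths l hmu)) = mu := by
  funext i
  rw [complementRows, rowLen_diagramOfRows (antitone_complementLengths l hmu)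
    (fun i hi => padded_of_le _ hi), complementLengths,
    padded_val, Fin.rev_rev]
  · have := hl i
    omega
  · intro i
    unfold complementLengths
    by_cases hi : i < n
    · rw [padded_of_lt _ hi]
      exact Nat.sub_le _ _
    · rw [padded_of_le _ (not_lt.1 hi)]
      exact Nat.zero_le _

/-! ### Plane partitions and fillings -/

namespace PlanePartition

variable {S : Finset (ℕ × ℕ)} {lam b : ℕ → ℕ}

theorem entry_pos_iff (T : PlanePartition S) {i j : ℕ} : 0 < T.entry i j ↔ (i, j) ∈ S := by
  refine ⟨fun h => ?_, T.pos i j⟩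
  by_contra H
  rw [T.zero i j H] at h
  exact lt_irrefl _ h

theorem isColumnStrictFilling (T : PlanePartition S) (hS : ∀ i j, (i, j) ∈ S ↔ j < lam i)
    (hlam : Antitone lam) (hT : T.ColumnStrict) (hb : T.RowBounded b) :
    IsColumnStrictFilling b lam T.entry where
  support i j := T.entry_pos_iff.trans (hS i j)
  row i j := by
    by_cases h : (i, j + 1) ∈ S
    · exact T.row_weak i j (j + 1) ((hS _ _).2 (by have := (hS _ _).1 h; omega)) h (by omega)
    · rw [T.zero _ _ h]
      exact Nat.zero_le _
  col i j h := by
    have h := T.entry_pos_iff.1 h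
    exact hT i (i + 1) j ((hS _ _).2 (((hS _ _).1 h).trans_le (hlam (Nat.le_succ i)))) h
      (Nat.lt_succ_self i)
  bound i j := by
    by_cases h : (i, j) ∈ S
    · exact hb i j h
    · rw [T.zero _ _ h]
      exact Nat.zero_le _

theorem isRowStrictFilling (T : PlanePartition S) (hS : ∀ i j, (i, j) ∈ S ↔ j < lam i)
    (hlam : Antitone lam) (hT : T.RowStrict) (hb : T.RowBounded b) :
    IsRowStrictFilling b lam T.entry where
  support i j := T.entry_pos_iff.trans (hS i j)
  row i j h := by
    have h := T.entry_pos_iff.1 h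
    exact hT i j (j + 1) ((hS _ _).2 (by have := (hS _ _).1 h; omega)) h (Nat.lt_succ_self j)
  col i j := by
    by_cases h : (i + 1, j) ∈ S
    · exact T.col_weak i (i + 1) j
        ((hS _ _).2 (((hS _ _).1 h).trans_le (hlam (Nat.le_succ i)))) h (Nat.lt_succ_self i)
    · rw [T.zero _ _ h]
      exact Nat.zero_le _
  bound i j := by
    by_cases h : (i, j) ∈ S
    · exact hb i j h
    · rw [T.zero _ _ h]
      exact Nat.zero_le _

end PlanePartition

namespace IsColumnStrictFilling

variable {b lam : ℕ → ℕ} {f : ℕ → ℕ → ℕ}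

theorem lt_of_lt (h : IsColumnStrictFilling b lam f) {i i' j : ℕ} (hi : i < i')
    (hpos : 0 < f i' j) : f i' j < f i j := by
  induction i', hi using Nat.le_induction with
  | base => exact h.col i j hpos
  | succ k hk ih =>
    have := h.col k j hpos
    exact this.trans (ih (by omega))

/-- The plane partition of a column-strict filling. -/
def toPlanePartition (h : IsColumnStrictFilling b lam f) {S : Finset (ℕ × ℕ)}
    (hS : ∀ i j, (i, j) ∈ S ↔ j < lam i) : PlanePartition S where
  entry := f
  pos i j hij := (h.support i j).2 ((hS i j).1 hij)
  zero i j hij := Nat.eq_zero_of_not_pos fun H => hij ((hS i j).2 ((h.support i j).1 H))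
  row_weak i _ _ _ _ hj := antitone_nat_of_succ_le (h.row i) hj.le
  col_weak _ i' j _ hi' hi := (h.lt_of_lt hi ((h.support i' j).2 ((hS i' j).1 hi'))).le

end IsColumnStrictFilling

namespace IsRowStrictFilling

variable {b lam : ℕ → ℕ} {f : ℕ → ℕ → ℕ}

theorem lt_of_lt (h : IsRowStrictFilling b lam f) {i j j' : ℕ} (hj : j < j')
    (hpos : 0 < f i j') : f i j' < f i j := by
  induction j', hj using Nat.le_induction with
  | base => exact h.row i j hpos
  | succ k hk ih =>
    have := h.row i k hpos
    exact this.trans (ih (by omega))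

theorem le_of_le (h : IsRowStrictFilling b lam f) {i i' j : ℕ} (hi : i ≤ i') :
    f i' j ≤ f i j :=
  antitone_nat_of_succ_le (f := fun i => f i j) (fun i => h.col i j) hi

/-- The plane partition of a row-strict filling. -/
def toPlanePartition (h : IsRowStrictFilling b lam f) {S : Finset (ℕ × ℕ)}
    (hS : ∀ i j, (i, j) ∈ S ↔ j < lam i) : PlanePartition S where
  entry := f
  pos i j hij := (h.support i j).2 ((hS i j).1 hij)
  zero i j hij := Nat.eq_zero_of_not_pos fun H => hij ((hS i j).2 ((h.support i j).1 H))
  row_weak i _ j' _ hj' hj := (h.lt_of_lt hj ((h.support i j').2 ((hS i j').1 hj'))).le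
  col_weak _ _ _ _ _ hi := h.le_of_le hi.le

end IsRowStrictFilling

theorem diagram_eq_of_entry_eq {D E : YoungDiagram} {P : PlanePartition D.cells}
    {P' : PlanePartition E.cells} (h : P.entry = P'.entry) : D = E := by
  refine YoungDiagram.ext (Finset.ext fun ⟨i, j⟩ => ?_)
  rw [← P.entry_pos_iff, ← P'.entry_pos_iff, h]

theorem antitone_padded {n : ℕ} {mu : Fin n → ℕ} (h : Antitone mu) : Antitone (padded mu) := by
  refine antitone_nat_of_succ_le fun i => ?_
  by_cases hi : i + 1 < n
  · rw [padded_of_lt _ hi, padded_of_lt _ (by omega : i < n)]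
    exact h (by simp)
  · rw [padded_of_le _ (not_lt.1 hi)]
    exact Nat.zero_le _

/-! ### The bijection for odd pairs -/

namespace OddPair

variable {n l : ℕ}

/-- The pair of fillings of an odd pair. -/
def toFillings (p : OddPair n l) : ((Fin n → ℕ) × (ℕ → ℕ → ℕ)) × (ℕ → ℕ → ℕ) :=
  ((complementRows n l p.shape, p.Q.entry), p.P.entry)

theorem bijOn_toFillings :
    Set.BijOn (toFillings (n := n) (l := l)) Set.univ (fillingPairs n l (n - 1)) := by
  refine ⟨fun p _ => ⟨?_, fun i => Nat.sub_le _ _, ?_⟩, fun p _ q _ h => ?_, ?_⟩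
  · exact p.Q.isRowStrictFilling (fun i j => mem_complementShape)
      (antitone_padded (antitone_complementRows n l p.shape)) p.Q_strict p.Q_bound
  · simp only [toFillings]
    rw [complementLengths_complementRows p.shape_le]
    exact p.P.isColumnStrictFilling (mem_cells_iff_lt_rowLen p.shape)
      (fun _ _ h => p.shape.rowLen_anti _ _ h) p.P_strict p.P_bound
  · obtain ⟨D, hD, P, hP, hPb, Q, hQ, hQb⟩ := p
    obtain ⟨E, hE, P', hP', hPb', Q', hQ', hQb'⟩ := q
    simp only [toFillings, Prod.mk.injEq] at h
    obtain ⟨⟨-, hQQ⟩, hPP⟩ := h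
    -- The positive entries of `P` determine its shape.
    obtain rfl := diagram_eq_of_entry_eq hPP
    obtain rfl := PlanePartition.ext hPP
    obtain rfl := PlanePartition.ext hQQ
    rfl
  · rintro ⟨⟨mu, g⟩, f⟩ ⟨hg, hl, hf⟩
    simp only at hg hl hf
    have hanti := antitone_of_padded hg.antitone
    have hrows := complementRows_diagramOfRows hanti hl
    have hD : (diagramOfRows n l (antitone_complementLengths l hanti)).cells ⊆ rectangle n l :=
      Finset.filter_subset _ _
    have hlen := complementLengths_complementRows hD
    generalize diagramOfRows n l (antitone_complementLengths l hanti) = D at *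
    subst hrows
    have hS := mem_cells_iff_lt_rowLen D
    rw [← hlen] at hS
    refine ⟨⟨D, hD, hf.toPlanePartition hS, fun i i' j _ hi' hi => ?_, fun i j _ => hf.bound i j,
      hg.toPlanePartition fun i j => mem_complementShape, fun i j j' _ hj' hj => ?_,
      fun i j _ => hg.bound i j⟩, Set.mem_univ _, rfl⟩
    · exact hf.lt_of_lt hi ((hf.support i' j).2 ((hS i' j).1 hi'))
    · exact hg.lt_of_lt hj ((hg.support i j').2 (mem_complementShape.1 hj'))

end OddPair

/-! ### The bijection for even pairs -/

namespace EvenPair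

variable {n l : ℕ}

/-- The filling obtained from `Q` by placing `n - i` in a deleted cell of row `i`. -/
def completedEntry (p : EvenPair n l) (i j : ℕ) : ℕ :=
  if (i, j) ∈ p.deleted then n - i else p.Q.entry i j

/-- The pair of fillings of an even pair. -/
def toFillings (p : EvenPair n l) : ((Fin n → ℕ) × (ℕ → ℕ → ℕ)) × (ℕ → ℕ → ℕ) :=
  ((complementRows n l p.shape, p.completedEntry), p.P.entry)

theorem lt_of_mem_complementShape {D : YoungDiagram} {i j : ℕ}
    (h : (i, j) ∈ complementShape n l D) : i < n :=
  (mem_rectangle.1 (Finset.mem_filter.1 h).1).1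

/-- The inserted n - i exceeds every entry of `Q` in row i and below, so rows stay strict and
columns weak; only an entry of `Q` above a deleted cell needs a condition, and that is `Q_deleted`.
-/
theorem isRowStrictFilling_completedEntry (p : EvenPair n l) :
    IsRowStrictFilling (fun i => n - i) (padded (complementRows n l p.shape))
      p.completedEntry := by
  have hanti := antitone_padded (antitone_complementRows n l p.shape)
  have hlt : ∀ i j, (i, j) ∈ p.deleted → i < n := fun i j h =>
    lt_of_mem_complementShape (p.deleted_subset h)
  have hb : ∀ i j, p.Q.entry i j ≤ n - 1 - i := fun i j => by
    by_cases h : (i, j) ∈ complementShape n l p.shape \ p.deleted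
    · exact p.Q_bound i j h
    · rw [p.Q.zero _ _ h]
      exact Nat.zero_le _
  refine ⟨fun i j => ?_, fun i j => ?_, fun i j => ?_, fun i j => ?_⟩
  · rw [← mem_complementShape]
    unfold completedEntry
    split_ifs with h
    · have h1 := hlt _ _ h
      exact ⟨fun _ => p.deleted_subset h, fun _ => by omega⟩
    · rw [p.Q.entry_pos_iff, Finset.mem_sdiff]
      exact ⟨fun H => H.1, fun H => ⟨H, h⟩⟩
  · intro hpos
    have h1 : (i, j + 1) ∉ p.deleted := fun h => absurd (p.deleted_col _ h) (by simp)
    unfold completedEntry at hpos ⊢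
    rw [if_neg h1] at hpos ⊢
    have h2 := p.Q.entry_pos_iff.1 hpos
    split_ifs with h
    · have := hlt _ _ h
      have := hb i (j + 1)
      omega
    · refine p.Q_strict i j (j + 1) (Finset.mem_sdiff.2 ⟨mem_complementShape.2 ?_, h⟩) h2
        (Nat.lt_succ_self j)
      have := mem_complementShape.1 (Finset.mem_sdiff.1 h2).1
      omega
  · have hup : (i + 1, j) ∈ complementShape n l p.shape → (i, j) ∈ complementShape n l p.shape :=
      fun h => mem_complementShape.2 ((mem_complementShape.1 h).trans_le (hanti (Nat.le_succ i)))
    unfold completedEntry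
    split_ifs with h h' h'
    · omega
    · obtain rfl : j = 0 := p.deleted_col _ h
      exact p.Q_deleted i (i + 1)
        (Finset.mem_sdiff.2 ⟨hup (p.deleted_subset h), h'⟩) h (Nat.lt_succ_self i)
    · have := hb (i + 1) j
      omega
    · by_cases hS : (i + 1, j) ∈ complementShape n l p.shape \ p.deleted
      · exact p.Q.col_weak i (i + 1) j
          (Finset.mem_sdiff.2 ⟨hup (Finset.mem_sdiff.1 hS).1, h'⟩) hS (Nat.lt_succ_self i)
      · rw [p.Q.zero _ _ hS]
        exact Nat.zero_le _
  · unfold completedEntry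
    have := hb i j
    split_ifs <;> omega

/-- The completed filling determines the deleted cells, because `Q` itself stays below n - i in row
i; injectivity rests on this. -/
theorem mem_deleted_iff (p : EvenPair n l) {i j : ℕ} :
    (i, j) ∈ p.deleted ↔
      (i, j) ∈ complementShape n l p.shape ∧ p.completedEntry i j = n - i := by
  unfold completedEntry
  split_ifs with h
  · exact ⟨fun _ => ⟨p.deleted_subset h, rfl⟩, fun _ => h⟩
  · refine ⟨fun H => absurd H h, fun ⟨H, he⟩ => ?_⟩
    have h1 := lt_of_mem_complementShape H
    have h2 := p.Q_bound i j (Finset.mem_sdiff.2 ⟨H, h⟩)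
    simp only at h2
    omega

theorem bijOn_toFillings :
    Set.BijOn (toFillings (n := n) (l := l)) Set.univ (fillingPairs n l n) := by
  refine ⟨fun p _ => ⟨p.isRowStrictFilling_completedEntry, fun i => Nat.sub_le _ _, ?_⟩,
    fun p _ q _ h => ?_, ?_⟩
  · simp only [toFillings]
    rw [complementLengths_complementRows p.shape_le]
    exact p.P.isColumnStrictFilling (mem_cells_iff_lt_rowLen p.shape)
      (fun _ _ h => p.shape.rowLen_anti _ _ h) p.P_strict p.P_bound
  · simp only [toFillings, Prod.mk.injEq] at h
    obtain ⟨⟨-, hQQ⟩, hPP⟩ := h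
    have hDE := diagram_eq_of_entry_eq hPP
    have hdel : p.deleted = q.deleted := by
      ext ⟨i, j⟩
      rw [mem_deleted_iff, mem_deleted_iff, hDE, hQQ]
    have hQQ' : p.Q.entry = q.Q.entry := by
      funext i j
      have h1 := congrFun (congrFun hQQ i) j
      unfold completedEntry at h1
      by_cases hd : (i, j) ∈ p.deleted
      · rw [p.Q.zero _ _ fun H => (Finset.mem_sdiff.1 H).2 hd,
          q.Q.zero _ _ fun H => (Finset.mem_sdiff.1 H).2 (hdel ▸ hd)]
      · rwa [if_neg hd, if_neg (hdel ▸ hd)] at h1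
    clear hQQ
    obtain ⟨D, hD, P, hP, hPb, d, hd, hdc, Q, hQ, hQb, hQd⟩ := p
    obtain ⟨E, hE, P', hP', hPb', d', hd', hdc', Q', hQ', hQb', hQd'⟩ := q
    simp only at hPP hDE hdel hQQ'
    subst hDE hdel
    obtain rfl := PlanePartition.ext hPP
    obtain rfl := PlanePartition.ext hQQ'
    rfl
  · rintro ⟨⟨mu, g⟩, f⟩ ⟨hg, hl, hf⟩
    simp only at hg hl hf
    have hanti := antitone_of_padded hg.antitone
    have hrows := complementRows_diagramOfRows hanti hl
    have hD : (diagramOfRows n l (antitone_complementLengths l hanti)).cells ⊆ rectangle n l :=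
      Finset.filter_subset _ _
    have hlen := complementLengths_complementRows hD
    generalize diagramOfRows n l (antitone_complementLengths l hanti) = D at *
    subst hrows
    have hS := mem_cells_iff_lt_rowLen D
    rw [← hlen] at hS
    -- Conversely, the cells to delete are those of the first column that attain the bound n - i.
    set d : Finset (ℕ × ℕ) := (complementShape n l D).filter fun c =>
      c.2 = 0 ∧ g c.1 c.2 = n - c.1 with hd
    have hmem : ∀ i j, (i, j) ∈ d ↔
        (i, j) ∈ complementShape n l D ∧ j = 0 ∧ g i j = n - i := fun i j => by
      rw [hd, Finset.mem_filter]
    have hC : ∀ i j, (i, j) ∈ complementShape n l D ↔ 0 < g i j := fun i j =>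
      mem_complementShape.trans (hg.support i j).symm
    have hsd : ∀ i j, (i, j) ∈ complementShape n l D \ d ↔ 0 < g i j ∧ (i, j) ∉ d :=
      fun i j => by rw [Finset.mem_sdiff, hC]
    let Q : PlanePartition (complementShape n l D \ d) :=
      { entry := fun i j => if (i, j) ∈ d then 0 else g i j
        pos := fun i j h => by
          rw [hsd] at h
          rw [if_neg h.2]
          exact h.1
        zero := fun i j h => by
          rw [hsd] at h
          split_ifs with hdd
          · rfl
          · exact Nat.eq_zero_of_not_pos fun H => h ⟨H, hdd⟩
        row_weak := fun i j j' h h' hj => by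
          rw [hsd] at h h'
          rw [if_neg h.2, if_neg h'.2]
          exact (hg.lt_of_lt hj h'.1).le
        col_weak := fun i i' j h h' hi => by
          rw [hsd] at h h'
          rw [if_neg h.2, if_neg h'.2]
          exact hg.le_of_le hi.le }
    refine ⟨⟨D, hD, hf.toPlanePartition hS, fun i i' j _ hi' hi => ?_, fun i j _ => hf.bound i j,
      d, Finset.filter_subset _ _, fun c hc => (Finset.mem_filter.1 hc).2.1,
      Q, fun i j j' h h' hj => ?_, fun i j h => ?_, fun i i' h h' hi => ?_⟩,
      Set.mem_univ _, ?_⟩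
    · exact hf.lt_of_lt hi ((hf.support i' j).2 ((hS i' j).1 hi'))
    · rw [hsd] at h h'
      simp only [Q, if_neg h.2, if_neg h'.2]
      exact hg.lt_of_lt hj h'.1
    · rw [hsd] at h
      simp only [Q, if_neg h.2]
      have h1 := hg.bound i j
      rcases Nat.eq_zero_or_pos j with rfl | hj
      · have : g i 0 ≠ n - i := fun H => h.2 ((hmem i 0).2 ⟨(hC i 0).2 h.1, rfl, H⟩)
        omega
      -- Away from the first column row-strictness alone forces the smaller bound n - 1 - i.
      · have := hg.lt_of_lt hj h.1
        have := hg.bound i 0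
        omega
    · rw [hsd] at h
      simp only [Q, if_neg h.2]
      rw [← ((hmem i' 0).1 h').2.2]
      exact hg.le_of_le hi.le
    · refine Prod.ext (Prod.ext rfl ?_) rfl
      funext i j
      simp only [toFillings, completedEntry, Q]
      split_ifs with h
      · exact ((hmem i j).1 h).2.2.symm
      · rfl

end EvenPair

/-! ### Transport of the generating functions to pairs -/

theorem fillingWeight_eq_entryWeight {K : Type*} [Field K] {n l : ℕ} (x : Fin n → K)
    {D : YoungDiagram} (hD : D.cells ⊆ rectangle n l) (P : PlanePartition D.cells)
    (hP : P.RowBounded fun i => 2 * n - 2 * i) :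
    entryWeight x P = fillingWeight (symplecticLetter x) n
      (complementLengths l (complementRows n l D)) P.entry := by
  rw [complementLengths_complementRows hD]
  exact entryWeight_eq_fillingWeight x P (mem_cells_iff_lt_rowLen D)
    (fun i hi => YoungDiagram.rowLen_eq_zero_of_subset_rectangle hD hi) hP

theorem mainTheorem5 (n l : ℕ) (hn : 1 ≤ n) :
    (n ≤ l + 2 →
      Finite (OddPair n l) ∧
      littlewoodRHS n (2 * l + 1) 0 (indet n) = ∑ᶠ p : OddPair n l, p.weight (indet n)) ∧
    (n ≤ l + 1 →
      Finite (EvenPair n l) ∧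
      littlewoodRHS n (2 * l) 0 (indet n) = ∑ᶠ p : EvenPair n l, p.weight (indet n)) := by
  refine ⟨fun hl => ?_, fun hl => ?_⟩
  · obtain ⟨hfin, hsum⟩ := littlewoodRHS_odd (isGeneric_indet n) hn hl
    have hbij := OddPair.bijOn_toFillings (n := n) (l := l)
    have hF : Finite (OddPair n l) :=
      Set.finite_univ_iff.1 (Set.Finite.of_finite_image (hbij.image_eq ▸ hfin) hbij.injOn)
    refine ⟨hF, ?_⟩
    rw [hsum, ← finsum_mem_eq_of_bijOn _ hbij fun p _ =>
      fillingWeight_eq_entryWeight (indet n) p.shape_le p.P p.P_bound,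
      mul_finsum_mem' _ _ Set.finite_univ, finsum_mem_univ]
    rfl
  · obtain ⟨hfin, hsum⟩ := littlewoodRHS_even (isGeneric_indet n) hl
    have hbij := EvenPair.bijOn_toFillings (n := n) (l := l)
    have hF : Finite (EvenPair n l) :=
      Set.finite_univ_iff.1 (Set.Finite.of_finite_image (hbij.image_eq ▸ hfin) hbij.injOn)
    refine ⟨hF, ?_⟩
    rw [hsum, ← finsum_mem_eq_of_bijOn _ hbij fun p _ =>
      fillingWeight_eq_entryWeight (indet n) p.shape_le p.P p.P_bound,
      mul_finsum_mem' _ _ Set.finite_univ, finsum_mem_univ]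
    rfl
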